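/- Let $d\ge 1$, let $H<\mathrm{GL}(d,\mathbb{R})$ be a closed subgroup with left Haar measure $dh$, and let $G=\mathbb{R}^d\rtimes H$ be the group of pairs $(x,h)$ with product $(x,h)(y,g)=(x+hy,hg)$ and left Haar measure $|\det h|^{-1}\,dx\,dh$. Let $\pi$ be the quasi-regular representation of $G$ on $L^2(\mathbb{R}^d)$, $$[\pi(x,h)f](y)=|\det h|^{-1/2}f\bigl(h^{-1}(y-x)\bigr).$$ A vector $\psi\in L^2(\mathbb{R}^d)$ is called admissible if the matrix coefficient $(x,h)\mapsto\langle\psi,\pi(x,h)\psi\rangle$ belongs to $L^2(G)$. The group $H$ is called irreducibly admissible if $\pi$ is irreducible and there is a nonzero admissible vector. An irreducibly admissible group $H$ is called a generalized shearlet dilation group if it has two closed subgroups $S,D<H$ such that 1. $S$ is connected and abelian and consists of upper triangular matrices with ones on the diagonal; 2. $D=\{\exp(rY):r\in\mathbb{R}\}$ for some diagonal matrix $Y$; 3. every $h\in H$ can be written uniquely as $h=\pm as$ with $a\in D$ and $s\in S$. **Theorem.** Let $H<\mathrm{GL}(d,\mathbb{R})$ be a generalized shearlet dilation group. Then $\psi\in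 L^2(\mathbb{R}^d)$ is admissible if and only if $$\int_{\mathbb{R}^d}\frac{|\widehat\psi(\xi)|^2}{|\xi_1|^d}\,d\xi<\infty,$$ where $\widehat\psi$ is the ($L^2$-)Fourier transform, given by $\widehat f(\xi)=\int_{\mathbb{R}^d}f(x)e^{-2\pi i\langle x,\xi\rangle}\,dx$ for $f\in L^1\cap L^2$. In particular the condition depends on $H$ only through the dimension $d$. -/

import Mathlib

open MeasureTheory
open scoped FourierTransform ENNReal

namespace ShearletDilation

/-- `L²(ℝᵈ)`, complex valued, with respect to Lebesgue measure. -/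
abbrev L2 (d : ℕ) : Type := Lp ℂ 2 (volume : Measure (EuclideanSpace ℝ (Fin d)))

/-- The group `GL(d, ℝ)` carries its Borel sigma-algebra. -/
instance instMeasurableSpaceGL (d : ℕ) : MeasurableSpace (GL (Fin d) ℝ) := borel _

instance instBorelSpaceGL (d : ℕ) : BorelSpace (GL (Fin d) ℝ) := ⟨rfl⟩

/-- The map `y ↦ h⁻¹ (y - x)` on `ℝᵈ`. -/
noncomputable def affineInv {d : ℕ} (x : EuclideanSpace ℝ (Fin d)) (h : GL (Fin d) ℝ)
    (y : EuclideanSpace ℝ (Fin d)) : EuclideanSpace ℝ (Fin d) :=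
  Matrix.toEuclideanLin ((h⁻¹ : GL (Fin d) ℝ) : Matrix (Fin d) (Fin d) ℝ) (y - x)

theorem measurable_affineInv {d : ℕ} (x : EuclideanSpace ℝ (Fin d)) (h : GL (Fin d) ℝ) :
    Measurable (affineInv x h) :=
  ((LinearMap.continuous_of_finiteDimensional _).comp (continuous_id.sub continuous_const)).measurable

theorem map_affineInv {d : ℕ} (x : EuclideanSpace ℝ (Fin d)) (h : GL (Fin d) ℝ) :
    ∃ c : ℝ≥0∞, c ≠ ∞ ∧
      Measure.map (affineInv x h) volume = c • (volume : Measure (EuclideanSpace ℝ (Fin d))) := by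
  set L := Matrix.toEuclideanLin ((h⁻¹ : GL (Fin d) ℝ) : Matrix (Fin d) (Fin d) ℝ) with hL
  have hdet : LinearMap.det L ≠ 0 := by
    have : LinearMap.det L = ((h⁻¹ : GL (Fin d) ℝ) : Matrix (Fin d) (Fin d) ℝ).det := by
      rw [hL, Matrix.toEuclideanLin, Matrix.toLpLin_eq_toLin, LinearMap.det_toLin]
    rw [this]
    exact ((Matrix.isUnit_iff_isUnit_det _).1 (h⁻¹).isUnit).ne_zero
  refine ⟨ENNReal.ofReal |(LinearMap.det L)⁻¹|, ENNReal.ofReal_ne_top, ?_⟩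
  rw [← Measure.map_linearMap_addHaar_eq_smul_addHaar volume hdet]
  have h1 : affineInv x h = L ∘ (fun y => y - x) := rfl
  rw [h1, ← Measure.map_map (LinearMap.continuous_of_finiteDimensional L).measurable
    (measurePreserving_sub_right volume x).measurable, (measurePreserving_sub_right volume x).map_eq]

theorem memLp_quasiRegular {d : ℕ} (x : EuclideanSpace ℝ (Fin d)) (h : GL (Fin d) ℝ) (f : L2 d) :
    MemLp (fun y => |(h : Matrix (Fin d) (Fin d) ℝ).det| ^ (-(1 / 2) : ℝ) • f (affineInv x h y))
      2 volume := by
  obtain ⟨c, hc, hmap⟩ := map_affineInv x h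
  have h1 : MemLp f 2 (Measure.map (affineInv x h) volume) := by
    rw [hmap]
    exact (Lp.memLp f).smul_measure hc
  have h2 : MemLp (f ∘ affineInv x h) 2 volume :=
    h1.comp_of_map (measurable_affineInv x h).aemeasurable
  exact h2.const_smul (|(h : Matrix (Fin d) (Fin d) ℝ).det| ^ (-(1 / 2) : ℝ))

/-- The operator `π(x, h)` of the quasi-regular representation of `ℝᵈ ⋊ GL(d, ℝ)` on `L²(ℝᵈ)`:
`(π(x, h) f)(y) = |det h|^(-1/2) f(h⁻¹ (y - x))`. -/
noncomputable def quasiRegular {d : ℕ} (x : EuclideanSpace ℝ (Fin d)) (h : GL (Fin d) ℝ)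
    (f : L2 d) : L2 d :=
  (memLp_quasiRegular x h f).toLp _

/-- The left Haar measure `|det h|⁻¹ dx dh` of `G = ℝᵈ ⋊ H`, with product
`(x, h) (y, g) = (x + h y, h g)`, where `dh = μ` is a left Haar measure of `H`. -/
noncomputable def affineHaar {d : ℕ} (H : Subgroup (GL (Fin d) ℝ)) (μ : Measure H) :
    Measure (EuclideanSpace ℝ (Fin d) × H) :=
  ((volume : Measure (EuclideanSpace ℝ (Fin d))).prod μ).withDensity
    fun p => ENNReal.ofReal |((p.2 : GL (Fin d) ℝ) : Matrix (Fin d) (Fin d) ℝ).det|⁻¹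

/-- `ψ` is admissible for `H` if the matrix coefficient `(x, h) ↦ ⟨ψ, π(x, h) ψ⟩` belongs to
`L²(G)`. (Mathlib's inner product is linear in its second argument.) -/
def IsAdmissible {d : ℕ} (H : Subgroup (GL (Fin d) ℝ)) (μ : Measure H) (ψ : L2 d) : Prop :=
  MemLp (fun p : EuclideanSpace ℝ (Fin d) × H => inner ℂ (quasiRegular p.1 p.2 ψ) ψ) 2
    (affineHaar H μ)

/-- The quasi-regular representation of `ℝᵈ ⋊ H` is (topologically) irreducible: the only closed
invariant subspaces are the trivial ones. -/
def IsIrreducibleRep {d : ℕ} (H : Subgroup (GL (Fin d) ℝ)) : Prop :=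
  ∀ K : Submodule ℂ (L2 d), IsClosed (K : Set (L2 d)) →
    (∀ x : EuclideanSpace ℝ (Fin d), ∀ h ∈ H, ∀ f ∈ K, quasiRegular x h f ∈ K) →
    K = ⊥ ∨ K = ⊤

/-- `H` is an irreducibly admissible dilation group: a closed subgroup of `GL(d, ℝ)` for which the
quasi-regular representation is irreducible and square-integrable, i.e. has a nonzero admissible
vector. -/
structure IsIrreduciblyAdmissible {d : ℕ} (H : Subgroup (GL (Fin d) ℝ)) : Prop where
  isClosed : IsClosed (H : Set (GL (Fin d) ℝ))
  irreducible : IsIrreducibleRep H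
  squareIntegrable : ∃ μ : Measure H, μ.IsHaarMeasure ∧ ∃ ψ : L2 d, ψ ≠ 0 ∧ IsAdmissible H μ ψ

/-- Upper triangular matrices with ones on the diagonal. -/
def IsUpperUnipotent {d : ℕ} (A : Matrix (Fin d) (Fin d) ℝ) : Prop :=
  (∀ i j, j < i → A i j = 0) ∧ ∀ i, A i i = 1

/-- `H` is a generalized shearlet dilation group: it is irreducibly admissible, with a shearing
subgroup `S` (closed, connected, abelian, unipotent upper triangular) and a diagonal complement
`D = exp(ℝ Y)`, `Y` diagonal, such that every `h ∈ H` is uniquely of the form `± a s` with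
`a ∈ D` and `s ∈ S`. -/
structure IsGeneralizedShearletGroup {d : ℕ} (H : Subgroup (GL (Fin d) ℝ)) : Prop where
  irreduciblyAdmissible : IsIrreduciblyAdmissible H
  exists_shearing_diagonal : ∃ S D : Subgroup (GL (Fin d) ℝ), S ≤ H ∧ D ≤ H ∧
    (IsClosed (S : Set (GL (Fin d) ℝ)) ∧ IsConnected (S : Set (GL (Fin d) ℝ)) ∧
      (∀ s ∈ S, ∀ t ∈ S, s * t = t * s) ∧
      ∀ s ∈ S, IsUpperUnipotent (s : Matrix (Fin d) (Fin d) ℝ)) ∧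
    (IsClosed (D : Set (GL (Fin d) ℝ)) ∧
      ∃ y : Fin d → ℝ, ∀ g : GL (Fin d) ℝ, g ∈ D ↔
        ∃ r : ℝ, (g : Matrix (Fin d) (Fin d) ℝ) = NormedSpace.exp (r • Matrix.diagonal y)) ∧
    ∀ h ∈ H, ∃! p : ℤˣ × D × S, (h : Matrix (Fin d) (Fin d) ℝ) =
      ((p.1 : ℤ) : ℝ) • ((p.2.1 * p.2.2 : GL (Fin d) ℝ) : Matrix (Fin d) (Fin d) ℝ)

end ShearletDilation

/-! On the Fourier side `π(x, h)` multiplies by a character in `x` and composes with the dual action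
`ξ ↦ hᵀ ξ`. Plancherel in `x` for fixed `h`, followed by Tonelli, turns the squared `L²(G)`-norm of
the coefficient into `∫ |ψ̂(ξ)|² ∫_H |ψ̂(hᵀ ξ)|² dh dξ` (`lintegral_enorm_coefficient_sq`).

Irreducibility makes every Borel set invariant under the dual action null or conull. Testing this on
explicit sets gives `y 0 ≠ 0`, `-1 ∈ H`, and that the first rows of shears are exactly the vectors
with leading entry 1 (`rowSurjective`): were column `k` unreachable, the `k`-th coordinate of a
normal form would be an invariant. The argument needs real powers of shears, supplied by the
nilpotent logarithm and the linearity of closed connected subgroups of a vector space. Since `S` is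
commutative, a shear with trivial first row is the identity. Hence `h ↦ hᵀ e₁`, the first row of
`h`, is a bijection from `H` onto `{ξ 0 ≠ 0}`, and the inner integral does not depend on `ξ`.

It remains to identify Haar measure on this orbit. Left multiplication by `-1` or a diagonal element
scales the first row by a scalar; left multiplication by a shear acts by a unipotent matrix
depending only on `ξ 0`. Both preserve `|ξ 0|⁻ᵈ dξ`, whatever `H` is, so uniqueness of Haar measure
(`exists_orbitMeasure_eq_smul_map`) finishes the proof. -/

namespace ShearletDilation

/-! ### Plancherel's formula for integrable functions. -/

section Plancherel

variable {E : Type*} [NormedAddCommGroup E] [InnerProductSpace ℝ E] [FiniteDimensional ℝ E]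
  [MeasurableSpace E] [BorelSpace E]

theorem integral_fourier_mul_eq_of_integrable {f g : E → ℂ} (hf : Integrable f) (hg : Integrable g) :
    ∫ ξ, 𝓕 f ξ * g ξ = ∫ x, f x * 𝓕 g x := by
  have := VectorFourier.integral_fourierIntegral_smul_eq_flip (μ := (volume : Measure E))
    (ν := (volume : Measure E)) (L := innerₗ E) Real.continuous_fourierChar continuous_inner hf hg
  simp only [flip_innerₗ, smul_eq_mul] at this
  exact this

theorem integral_fourierInv_mul_eq_of_integrable {f g : E → ℂ} (hf : Integrable f)
    (hg : Integrable g) : ∫ ξ, 𝓕⁻ f ξ * g ξ = ∫ x, f x * 𝓕⁻ g x := by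
  have h1 : ∀ f : E → ℂ, ∀ ξ, 𝓕⁻ f ξ = 𝓕 f (-ξ) := fun f ξ => by
    rw [Real.fourierInv_eq_fourier_neg]
  have h2 : ∀ f : E → ℂ, ∀ ξ, 𝓕⁻ f ξ = 𝓕 (fun x => f (-x)) ξ := fun f ξ => by
    rw [Real.fourierInv_eq_fourier_comp_neg]
  simp_rw [h2 f]
  rw [integral_fourier_mul_eq_of_integrable hf.comp_neg hg,
    ← integral_neg_eq_self]
  simp [h1]

theorem continuous_fourier_of_integrable {f : E → ℂ} (hf : Integrable f) : Continuous (𝓕 f) :=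
  VectorFourier.fourierIntegral_continuous Real.continuous_fourierChar continuous_inner hf

/-- Compactly supported smooth functions are Schwartz and already separate locally integrable
functions. -/
theorem ae_eq_of_integral_schwartz_mul_eq {f g : E → ℂ} (hf : LocallyIntegrable f)
    (hg : LocallyIntegrable g)
    (h : ∀ φ : SchwartzMap E ℂ, ∫ x, φ x * f x = ∫ x, φ x * g x) : f =ᵐ[volume] g := by
  refine ae_eq_of_integral_contDiff_smul_eq hf hg fun φ hφ hc => ?_
  have hc' : HasCompactSupport (fun x => (φ x : ℂ)) := hc.comp_left (g := fun t : ℝ => (t : ℂ)) (by simp)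
  have hφ' : ContDiff ℝ (⊤ : ℕ∞) (fun x => (φ x : ℂ)) := Complex.ofRealCLM.contDiff.comp hφ
  simpa [Complex.real_smul] using h (hc'.toSchwartzMap hφ')

theorem locallyIntegrable_coe_Lp_two (f : Lp ℂ 2 (volume : Measure E)) : LocallyIntegrable f :=
  (Lp.memLp f).locallyIntegrable (by norm_num)

/-- The `L²` transform agrees with the distributional one, which is defined by moving the transform
to the test function. -/
theorem integral_schwartz_mul_fourier (f : Lp ℂ 2 (volume : Measure E)) (φ : SchwartzMap E ℂ) :
    ∫ x, φ x * (𝓕 f : Lp ℂ 2 (volume : Measure E)) x = ∫ x, (𝓕 φ) x * f x := by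
  have := congrArg (fun T => T φ) (Lp.fourier_toTemperedDistribution_eq f)
  simpa [TemperedDistribution.fourier_apply, Lp.toTemperedDistribution_apply] using this.symm

theorem integral_schwartz_mul_fourierInv (f : Lp ℂ 2 (volume : Measure E)) (φ : SchwartzMap E ℂ) :
    ∫ x, φ x * (𝓕⁻ f : Lp ℂ 2 (volume : Measure E)) x = ∫ x, (𝓕⁻ φ) x * f x := by
  have := congrArg (fun T => T φ) (Lp.fourierInv_toTemperedDistribution_eq f)
  simpa [TemperedDistribution.fourierInv_apply, Lp.toTemperedDistribution_apply] using this.symm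

/-- On `L¹ ∩ L²` the `L²`-Fourier transform is given by the Fourier integral. -/
theorem fourier_toLp_ae_eq {f : E → ℂ} (hf : Integrable f) (hf2 : MemLp f 2) :
    (𝓕 (hf2.toLp f) : Lp ℂ 2 (volume : Measure E)) =ᵐ[volume] 𝓕 f := by
  refine ae_eq_of_integral_schwartz_mul_eq (locallyIntegrable_coe_Lp_two _)
    (continuous_fourier_of_integrable hf).locallyIntegrable fun φ => ?_
  rw [integral_schwartz_mul_fourier]
  have h1 : ∫ x, (𝓕 φ) x * (hf2.toLp f) x = ∫ x, (𝓕 φ) x * f x :=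
    integral_congr_ae (by filter_upwards [hf2.coeFn_toLp] with x hx; rw [hx])
  rw [h1, SchwartzMap.fourier_coe, integral_fourier_mul_eq_of_integrable φ.integrable hf]

theorem fourierInv_toLp_ae_eq {f : E → ℂ} (hf : Integrable f) (hf2 : MemLp f 2) :
    (𝓕⁻ (hf2.toLp f) : Lp ℂ 2 (volume : Measure E)) =ᵐ[volume] 𝓕⁻ f := by
  have hc : Continuous (𝓕⁻ f) := by
    have : 𝓕⁻ f = fun x => 𝓕 f (-x) := by ext x; rw [Real.fourierInv_eq_fourier_neg]
    rw [this]
    exact (continuous_fourier_of_integrable hf).comp continuous_neg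
  refine ae_eq_of_integral_schwartz_mul_eq (locallyIntegrable_coe_Lp_two _)
    hc.locallyIntegrable fun φ => ?_
  rw [integral_schwartz_mul_fourierInv]
  have h1 : ∫ x, (𝓕⁻ φ) x * (hf2.toLp f) x = ∫ x, (𝓕⁻ φ) x * f x :=
    integral_congr_ae (by filter_upwards [hf2.coeFn_toLp] with x hx; rw [hx])
  rw [h1, SchwartzMap.fourierInv_coe, integral_fourierInv_mul_eq_of_integrable φ.integrable hf]

/-- An integrable function whose inverse Fourier integral is square integrable is the
`L²`-Fourier transform of the latter. -/
theorem fourier_toLp_fourierInv_ae_eq {g : E → ℂ} (hg : Integrable g) (hu : MemLp (𝓕⁻ g) 2) :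
    (𝓕 (hu.toLp (𝓕⁻ g)) : Lp ℂ 2 (volume : Measure E)) =ᵐ[volume] g := by
  refine ae_eq_of_integral_schwartz_mul_eq (locallyIntegrable_coe_Lp_two _)
    hg.locallyIntegrable fun φ => ?_
  rw [integral_schwartz_mul_fourier]
  have h1 : ∫ x, (𝓕 φ) x * (hu.toLp (𝓕⁻ g)) x = ∫ x, (𝓕⁻ g) x * (𝓕 φ) x :=
    integral_congr_ae (by filter_upwards [hu.coeFn_toLp] with x hx; rw [hx, mul_comm])
  rw [h1, integral_fourierInv_mul_eq_of_integrable hg (𝓕 φ).integrable,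
    ← SchwartzMap.fourierInv_coe, FourierTransform.fourierInv_fourier_eq]
  simp_rw [mul_comm]

theorem lintegral_enorm_sq_eq_enorm_sq (f : Lp ℂ 2 (volume : Measure E)) :
    ∫⁻ x, ‖f x‖ₑ ^ 2 = ‖f‖ₑ ^ 2 := by
  rw [Lp.enorm_def, eLpNorm_eq_lintegral_rpow_enorm_toReal (by norm_num) (by norm_num),
    ← ENNReal.rpow_natCast, ← ENNReal.rpow_mul]
  simp

/-- Plancherel's formula for integrable functions, with both sides possibly infinite. -/
theorem lintegral_enorm_fourierInv_sq {g : E → ℂ} (hg : Integrable g) :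
    ∫⁻ x, ‖𝓕⁻ g x‖ₑ ^ 2 = ∫⁻ ξ, ‖g ξ‖ₑ ^ 2 := by
  have hc : Continuous (𝓕⁻ g) := by
    have : 𝓕⁻ g = fun x => 𝓕 g (-x) := by ext x; rw [Real.fourierInv_eq_fourier_neg]
    rw [this]
    exact (continuous_fourier_of_integrable hg).comp continuous_neg
  have key : ∀ (u : Lp ℂ 2 (volume : Measure E)) (a b : E → ℂ), u =ᵐ[volume] a →
      (𝓕 u : Lp ℂ 2 (volume : Measure E)) =ᵐ[volume] b → ∫⁻ x, ‖a x‖ₑ ^ 2 = ∫⁻ x, ‖b x‖ₑ ^ 2 := by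
    intro u a b ha hb
    have h1 : ∫⁻ x, ‖a x‖ₑ ^ 2 = ∫⁻ x, ‖u x‖ₑ ^ 2 :=
      lintegral_congr_ae (by filter_upwards [ha] with x hx; rw [hx])
    have h2 : ∫⁻ x, ‖b x‖ₑ ^ 2 = ∫⁻ x, ‖(𝓕 u : Lp ℂ 2 (volume : Measure E)) x‖ₑ ^ 2 :=
      lintegral_congr_ae (by filter_upwards [hb] with x hx; rw [hx])
    rw [h1, h2, lintegral_enorm_sq_eq_enorm_sq, lintegral_enorm_sq_eq_enorm_sq]
    congr 1
    simp [enorm_eq_nnnorm, ← NNReal.coe_inj]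
  -- If either `𝓕⁻ g` or `g` is square integrable, the `L²` isometry relates the two; otherwise both
  -- integrals are infinite.
  by_cases hu : MemLp (𝓕⁻ g) 2
  · exact key _ _ _ hu.coeFn_toLp (fourier_toLp_fourierInv_ae_eq hg hu)
  by_cases hg2 : MemLp g 2
  · refine key (𝓕⁻ (hg2.toLp g)) _ _ (fourierInv_toLp_ae_eq hg hg2) ?_
    rw [FourierTransform.fourier_fourierInv_eq]
    exact hg2.coeFn_toLp
  have top : ∀ v : E → ℂ, AEStronglyMeasurable v volume → ¬ MemLp v 2 →
      ∫⁻ x, ‖v x‖ₑ ^ 2 = ∞ := by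
    intro v hv hv2
    by_contra h
    refine hv2 ⟨hv, ?_⟩
    rw [eLpNorm_lt_top_iff_lintegral_rpow_enorm_lt_top (by norm_num) (by norm_num)]
    simpa using lt_top_iff_ne_top.2 h
  rw [top _ hc.aestronglyMeasurable hu, top _ hg.aestronglyMeasurable hg2]

end Plancherel

end ShearletDilation

namespace ShearletDilation

/-! ### The quasi-regular representation on the Fourier side. -/

section WeightedComposition

variable {E : Type*} [MeasureSpace E]

theorem eLpNorm_mul_comp_le {T : E → E} (hT : Measurable T) {c : ℝ≥0∞}
    (hmap : Measure.map T (volume : Measure E) = c • volume) {w : E → ℂ} {M : ℝ}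
    (hM : ∀ y, ‖w y‖ ≤ M) {f : E → ℂ} (hf : AEStronglyMeasurable f volume) :
    eLpNorm (fun y => w y * f (T y)) 2 volume ≤
      ENNReal.ofReal M * (c ^ (1 / (2 : ℝ≥0∞)).toReal * eLpNorm f 2 volume) := by
  have h1 : eLpNorm (fun y => f (T y)) 2 volume = eLpNorm f 2 (c • volume) := by
    rw [← hmap, eLpNorm_map_measure _ hT.aemeasurable]
    · rfl
    · rw [hmap]; exact hf.smul_measure c
  rw [eLpNorm_smul_measure_of_ne_top (by norm_num), smul_eq_mul] at h1
  rw [← h1]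
  exact eLpNorm_le_mul_eLpNorm_of_ae_le_mul (ae_of_all _ fun y => by
    rw [norm_mul]; gcongr; exact hM y) 2

theorem memLp_mul_comp {T : E → E} (hT : Measurable T) {c : ℝ≥0∞} (hc : c ≠ ∞)
    (hmap : Measure.map T (volume : Measure E) = c • volume) {w : E → ℂ} (hw : Measurable w) {M : ℝ}
    (hM : ∀ y, ‖w y‖ ≤ M) {f : E → ℂ} (hf : MemLp f 2) : MemLp (fun y => w y * f (T y)) 2 := by
  refine ⟨hw.aestronglyMeasurable.mul ?_, ?_⟩
  · have : AEStronglyMeasurable f (Measure.map T volume) := by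
      rw [hmap]; exact hf.1.smul_measure c
    exact this.comp_measurable hT
  · refine (eLpNorm_mul_comp_le hT hmap hM hf.1).trans_lt ?_
    exact ENNReal.mul_lt_top ENNReal.ofReal_lt_top
      (ENNReal.mul_lt_top (ENNReal.rpow_lt_top_of_nonneg (by simp) hc) hf.2)

/-- Weighted composition operators are bounded on `L²`. -/
theorem exists_clm_mul_comp {T : E → E} (hT : Measurable T) {c : ℝ≥0∞} (hc : c ≠ ∞)
    (hmap : Measure.map T (volume : Measure E) = c • volume) {w : E → ℂ} (hw : Measurable w) {M : ℝ}
    (hM : ∀ y, ‖w y‖ ≤ M) :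
    ∃ W : Lp ℂ 2 (volume : Measure E) →L[ℂ] Lp ℂ 2 (volume : Measure E),
      ∀ f, W f =ᵐ[volume] fun y => w y * f (T y) := by
  have hq : Measure.QuasiMeasurePreserving T volume volume :=
    ⟨hT, by rw [hmap]; exact Measure.smul_absolutelyContinuous⟩
  have hmem := fun f : Lp ℂ 2 (volume : Measure E) => memLp_mul_comp hT hc hmap hw hM (Lp.memLp f)
  let W₀ : Lp ℂ 2 (volume : Measure E) →ₗ[ℂ] Lp ℂ 2 (volume : Measure E) :=
    { toFun := fun f => (hmem f).toLp _
      map_add' := fun f g => by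
        apply Lp.ext
        filter_upwards [(hmem (f + g)).coeFn_toLp, (hmem f).coeFn_toLp, (hmem g).coeFn_toLp,
          Lp.coeFn_add ((hmem f).toLp _) ((hmem g).toLp _), hq.ae (Lp.coeFn_add f g)]
          with y h1 h2 h3 h4 h5
        rw [h1, h4, Pi.add_apply, h2, h3, h5, Pi.add_apply]
        ring
      map_smul' := fun a f => by
        apply Lp.ext
        filter_upwards [(hmem (a • f)).coeFn_toLp, (hmem f).coeFn_toLp,
          Lp.coeFn_smul a ((hmem f).toLp _), hq.ae (Lp.coeFn_smul a f)] with y h1 h2 h3 h4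
        simp only [RingHom.id_apply]
        rw [h1, h3, Pi.smul_apply, h2, h4, Pi.smul_apply]
        simp only [smul_eq_mul]
        ring }
  refine ⟨W₀.mkContinuous (ENNReal.ofReal M * c ^ (1 / (2 : ℝ≥0∞)).toReal).toReal fun f => ?_,
    fun f => (hmem f).coeFn_toLp⟩
  have h1 := eLpNorm_mul_comp_le hT hmap hM (Lp.memLp f).1
  change ‖(hmem f).toLp _‖ ≤ _
  rw [Lp.norm_toLp, Lp.norm_def, ← ENNReal.toReal_mul, mul_assoc]
  refine ENNReal.toReal_mono ?_ h1
  exact (ENNReal.mul_lt_top ENNReal.ofReal_lt_top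
      (ENNReal.mul_lt_top (ENNReal.rpow_lt_top_of_nonneg (by simp) hc) (Lp.memLp f).2)).ne

end WeightedComposition

variable {d : ℕ}

/-- The dual action `ξ ↦ hᵀ ξ`. -/
noncomputable def dualAct (h : GL (Fin d) ℝ) :
    EuclideanSpace ℝ (Fin d) →ₗ[ℝ] EuclideanSpace ℝ (Fin d) :=
  Matrix.toEuclideanLin (h : Matrix (Fin d) (Fin d) ℝ).transpose

theorem dualAct_apply (h : GL (Fin d) ℝ) (ξ : EuclideanSpace ℝ (Fin d)) (j : Fin d) :
    dualAct h ξ j = ∑ i, ξ i * (h : Matrix (Fin d) (Fin d) ℝ) i j := by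
  simp [dualAct, Matrix.mulVec, dotProduct, mul_comm]

/-- Transposition reverses products, so this is a right action. Hence left translation on `H`
becomes a change of base point in the orbit. -/
theorem dualAct_mul (g h : GL (Fin d) ℝ) (ξ : EuclideanSpace ℝ (Fin d)) :
    dualAct (g * h) ξ = dualAct h (dualAct g ξ) := by
  simp [dualAct, Matrix.transpose_mul]

theorem dualAct_one (ξ : EuclideanSpace ℝ (Fin d)) : dualAct 1 ξ = ξ := by
  simp [dualAct]

theorem inner_toEuclideanLin (h : GL (Fin d) ℝ) (x ξ : EuclideanSpace ℝ (Fin d)) :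
    inner ℝ (Matrix.toEuclideanLin (h : Matrix (Fin d) (Fin d) ℝ) x) ξ = inner ℝ x (dualAct h ξ) := by
  have := LinearMap.adjoint_inner_right (Matrix.toEuclideanLin (h : Matrix (Fin d) (Fin d) ℝ)) x ξ
  rw [← Matrix.toEuclideanLin_conjTranspose_eq_adjoint] at this
  rw [← this, dualAct, Matrix.conjTranspose_eq_transpose_of_trivial]

theorem det_ne_zero_GL (h : GL (Fin d) ℝ) : (h : Matrix (Fin d) (Fin d) ℝ).det ≠ 0 :=
  ((Matrix.isUnit_iff_isUnit_det _).1 h.isUnit).ne_zero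

theorem det_toEuclideanLin (A : Matrix (Fin d) (Fin d) ℝ) :
    LinearMap.det (Matrix.toEuclideanLin A) = A.det := by
  rw [Matrix.toEuclideanLin, Matrix.toLpLin_eq_toLin, LinearMap.det_toLin]

theorem map_toEuclideanLin (A : Matrix (Fin d) (Fin d) ℝ) (hA : A.det ≠ 0) :
    Measure.map (Matrix.toEuclideanLin A) volume =
      ENNReal.ofReal |A.det|⁻¹ • (volume : Measure (EuclideanSpace ℝ (Fin d))) := by
  rw [← det_toEuclideanLin] at hA ⊢
  rw [Measure.map_linearMap_addHaar_eq_smul_addHaar volume hA, abs_inv]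

theorem map_dualAct (h : GL (Fin d) ℝ) :
    Measure.map (dualAct h) volume = ENNReal.ofReal |(h : Matrix (Fin d) (Fin d) ℝ).det|⁻¹ •
      (volume : Measure (EuclideanSpace ℝ (Fin d))) := by
  rw [dualAct, map_toEuclideanLin _ (by rw [Matrix.det_transpose]; exact det_ne_zero_GL h),
    Matrix.det_transpose]

theorem continuous_dualAct (h : GL (Fin d) ℝ) : Continuous (dualAct h) :=
  LinearMap.continuous_of_finiteDimensional _

theorem quasiMeasurePreserving_dualAct (h : GL (Fin d) ℝ) :
    Measure.QuasiMeasurePreserving (dualAct h) volume volume :=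
  ⟨(continuous_dualAct h).measurable, by
    rw [map_dualAct]; exact Measure.smul_absolutelyContinuous⟩

theorem map_affineInv_eq (x : EuclideanSpace ℝ (Fin d)) (h : GL (Fin d) ℝ) :
    Measure.map (affineInv x h) volume = ENNReal.ofReal |(h : Matrix (Fin d) (Fin d) ℝ).det| •
      (volume : Measure (EuclideanSpace ℝ (Fin d))) := by
  have h1 : affineInv x h =
      (Matrix.toEuclideanLin ((h⁻¹ : GL (Fin d) ℝ) : Matrix (Fin d) (Fin d) ℝ)) ∘ (fun y => y - x) := rfl
  rw [h1, ← Measure.map_map (LinearMap.continuous_of_finiteDimensional _).measurable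
    (measurePreserving_sub_right volume x).measurable, (measurePreserving_sub_right volume x).map_eq,
    map_toEuclideanLin _ (det_ne_zero_GL h⁻¹)]
  congr 2
  have : (h : Matrix (Fin d) (Fin d) ℝ).det * ((h⁻¹ : GL (Fin d) ℝ) : Matrix (Fin d) (Fin d) ℝ).det = 1 := by
    rw [← Matrix.det_mul, ← Units.val_mul]; simp
  rw [eq_comm, ← abs_inv, ← eq_inv_of_mul_eq_one_left this]

/-- Substitute `y = h z + x`. Continuity provides measurability; the change of variables needs no
integrability. -/
theorem fourier_comp_affineInv (x : EuclideanSpace ℝ (Fin d)) (h : GL (Fin d) ℝ)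
    {f : EuclideanSpace ℝ (Fin d) → ℂ} (hf : Continuous f) (ξ : EuclideanSpace ℝ (Fin d)) :
    𝓕 (fun y => f (affineInv x h y)) ξ = |(h : Matrix (Fin d) (Fin d) ℝ).det| •
      (𝐞 (-inner ℝ x ξ) • 𝓕 f (dualAct h ξ)) := by
  set A := Matrix.toEuclideanLin (h : Matrix (Fin d) (Fin d) ℝ)
  have hA : ∀ y, A (affineInv x h y) = y - x := fun y => by
    ext i
    simp only [A, affineInv, Matrix.toLpLin_apply, Matrix.mulVec_mulVec, ← Units.val_mul,
      mul_inv_cancel, Units.val_one, Matrix.one_mulVec]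
  have hAc : Continuous A := LinearMap.continuous_of_finiteDimensional _
  rw [Real.fourier_eq]
  have h1 : ∀ y, 𝐞 (-inner ℝ y ξ) • f (affineInv x h y) =
      (fun z => 𝐞 (-inner ℝ (A z + x) ξ) • f z) (affineInv x h y) := fun y => by simp [hA]
  simp_rw [h1]
  rw [← integral_map (f := fun z => (𝐞 (-inner ℝ (A z + x) ξ) • f z : ℂ))
    (measurable_affineInv x h).aemeasurable, map_affineInv_eq, integral_smul_measure,
    ENNReal.toReal_ofReal (abs_nonneg _), Real.fourier_eq,
    Circle.smul_def (𝐞 (-inner ℝ x ξ)), ← integral_smul ((𝐞 (-inner ℝ x ξ) : Circle) : ℂ)]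
  · refine congrArg _ (integral_congr_ae (ae_of_all _ fun z => ?_))
    simp only [A]
    rw [inner_add_left, inner_toEuclideanLin, neg_add_rev, AddChar.map_add_eq_mul, mul_smul]
    rfl
  · refine Continuous.aestronglyMeasurable ?_
    exact ((Real.continuous_fourierChar.comp (by fun_prop))).smul hf

theorem fourier_schwartz_toLp_ae_eq (φ : SchwartzMap (EuclideanSpace ℝ (Fin d)) ℂ) :
    (𝓕 (φ.toLp 2 volume) : L2 d) =ᵐ[volume] 𝓕 (φ : EuclideanSpace ℝ (Fin d) → ℂ) := by
  rw [SchwartzMap.toLp_fourier_eq, ← SchwartzMap.fourier_coe]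
  exact SchwartzMap.coeFn_toLp _ 2 volume

/-- The quasi-regular representation on the Fourier side. -/
theorem fourier_quasiRegular (x : EuclideanSpace ℝ (Fin d)) (h : GL (Fin d) ℝ) (f : L2 d) :
    (𝓕 (quasiRegular x h f) : L2 d) =ᵐ[volume] fun ξ =>
      ((|(h : Matrix (Fin d) (Fin d) ℝ).det| ^ (1 / 2 : ℝ) : ℝ) : ℂ) * (𝐞 (-inner ℝ x ξ) : ℂ) *
        (𝓕 f : L2 d) (dualAct h ξ) := by
  set D := |(h : Matrix (Fin d) (Fin d) ℝ).det|
  have hD : 0 < D := abs_pos.2 (det_ne_zero_GL h)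
  obtain ⟨W, hW⟩ := exists_clm_mul_comp (measurable_affineInv x h) ENNReal.ofReal_ne_top
    (map_affineInv_eq x h) (w := fun _ => ((D ^ (-(1 / 2) : ℝ) : ℝ) : ℂ)) measurable_const
    (fun _ => le_rfl)
  obtain ⟨R, hR⟩ := exists_clm_mul_comp (continuous_dualAct h).measurable ENNReal.ofReal_ne_top
    (map_dualAct h) (w := fun ξ => ((D ^ (1 / 2 : ℝ) : ℝ) : ℂ) * (𝐞 (-inner ℝ x ξ) : ℂ))
    (M := D ^ (1 / 2 : ℝ))
    (Continuous.measurable (by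
      refine continuous_const.mul (continuous_subtype_val.comp (Real.continuous_fourierChar.comp ?_))
      fun_prop))
    (fun ξ => by
      rw [norm_mul, Circle.norm_coe, mul_one, Complex.norm_real, Real.norm_of_nonneg (by positivity)])
  have hWq : ∀ f : L2 d, quasiRegular x h f = W f := fun f => by
    apply Lp.ext
    filter_upwards [(memLp_quasiRegular x h f).coeFn_toLp, hW f] with y h1 h2
    rw [h2, quasiRegular, h1, Complex.real_smul]
  suffices 𝓕 (quasiRegular x h f) = R (𝓕 f) by rw [this]; exact hR _
  rw [hWq]
  -- Both sides are continuous in `f`, so Schwartz functions suffice, and there the transform is an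
  -- integral.
  refine DenseRange.induction_on (p := fun f : L2 d => 𝓕 (W f) = R (𝓕 f))
    (SchwartzMap.denseRange_toLpCLM (F := ℂ) (p := 2) ENNReal.ofNat_ne_top) f ?_ fun φ => ?_
  · exact isClosed_eq ((Lp.fourierTransformₗᵢ (EuclideanSpace ℝ (Fin d)) ℂ).continuous.comp W.continuous)
      (R.continuous.comp (Lp.fourierTransformₗᵢ (EuclideanSpace ℝ (Fin d)) ℂ).continuous)
  · rw [SchwartzMap.toLpCLM_apply]
    have hq : Measure.QuasiMeasurePreserving (affineInv x h) volume volume :=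
      ⟨measurable_affineInv x h, by
        rw [map_affineInv_eq]; exact Measure.smul_absolutelyContinuous⟩
    set F : EuclideanSpace ℝ (Fin d) → ℂ :=
      fun y => ((D ^ (-(1 / 2) : ℝ) : ℝ) : ℂ) * φ (affineInv x h y) with hF
    have e0 : ∀ᵐ z, (φ.toLp 2 volume : L2 d) z = φ z := φ.coeFn_toLp 2 volume
    have e0' := fourier_schwartz_toLp_ae_eq φ
    generalize φ.toLp 2 volume = Φ at e0 e0' ⊢
    have e1 : W Φ =ᵐ[volume] F := by
      filter_upwards [hW Φ, hq.ae e0] with y h1 h2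
      rw [h1, h2]
    have hF2 : MemLp F 2 := (Lp.memLp (W Φ)).ae_eq e1
    have hF1 : Integrable F := by
      refine Integrable.const_mul ?_ _
      have : Integrable φ (Measure.map (affineInv x h) volume) := by
        rw [map_affineInv_eq]; exact φ.integrable.smul_measure ENNReal.ofReal_ne_top
      exact this.comp_measurable (measurable_affineInv x h)
    have e2 : W Φ = hF2.toLp F := by
      apply Lp.ext; exact e1.trans hF2.coeFn_toLp.symm
    rw [e2]
    apply Lp.ext
    filter_upwards [fourier_toLp_ae_eq hF1 hF2, hR (𝓕 Φ),
      (quasiMeasurePreserving_dualAct h).ae e0'] with ξ h1 h2 h3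
    rw [h1, h2, h3]
    have e3 : F = ((D ^ (-(1 / 2) : ℝ) : ℝ) : ℂ) • fun y => φ (affineInv x h y) := rfl
    have e4 : 𝓕 F ξ = ((D ^ (-(1 / 2) : ℝ) : ℝ) : ℂ) * 𝓕 (fun y => φ (affineInv x h y)) ξ := by
      rw [e3, Real.fourier_eq, Real.fourier_eq, ← integral_const_mul]
      refine integral_congr_ae (ae_of_all _ fun y => ?_)
      simp only [Pi.smul_apply, Circle.smul_def, smul_eq_mul]
      ring
    rw [e4, fourier_comp_affineInv x h φ.continuous, Circle.smul_def,
      Complex.real_smul, smul_eq_mul]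
    change _ * ((D : ℂ) * _) = _
    -- The Jacobian `|det h|` turns the normalising power `-1/2` into `1/2`.
    have e5 : D ^ (1 / 2 : ℝ) = D ^ (-(1 / 2) : ℝ) * D := by
      rw [← Real.rpow_add_one hD.ne']; norm_num
    rw [e5]; push_cast; ring

end ShearletDilation

namespace ShearletDilation

variable {d : ℕ}

/-! ### Irreducibility and invariant sets of the dual action. -/

section Ergodicity

/-- The vectors whose Fourier transform vanishes almost everywhere on `s`. -/
noncomputable def fourierVanishing (s : Set (EuclideanSpace ℝ (Fin d))) : Submodule ℂ (L2 d) :=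
  LinearMap.ker ((LpToLpRestrictCLM (EuclideanSpace ℝ (Fin d)) ℂ ℂ volume 2 s).comp
    ((Lp.fourierTransformₗᵢ (EuclideanSpace ℝ (Fin d)) ℂ).toContinuousLinearEquiv :
      L2 d →L[ℂ] L2 d)).toLinearMap

theorem isClosed_fourierVanishing (s : Set (EuclideanSpace ℝ (Fin d))) :
    IsClosed (fourierVanishing s : Set (L2 d)) :=
  ContinuousLinearMap.isClosed_ker _

theorem mem_fourierVanishing {s : Set (EuclideanSpace ℝ (Fin d))} {f : L2 d} :
    f ∈ fourierVanishing s ↔ ∀ᵐ ξ ∂(volume.restrict s), (𝓕 f : L2 d) ξ = 0 := by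
  have h1 : f ∈ fourierVanishing s ↔
      LpToLpRestrictCLM (EuclideanSpace ℝ (Fin d)) ℂ ℂ volume 2 s (𝓕 f) = 0 := Iff.rfl
  have h2 := LpToLpRestrictCLM_coeFn (F := ℂ) (p := 2) (μ := (volume : Measure (EuclideanSpace ℝ (Fin d))))
    ℂ s (𝓕 f)
  rw [h1, Lp.eq_zero_iff_ae_eq_zero]
  constructor
  · intro h
    filter_upwards [h2, h] with ξ a b
    rw [← a, b]; rfl
  · intro h
    filter_upwards [h2, h] with ξ a b
    rw [a, b]; rfl

/-- The indicator of `B` itself need not be in `L²`, so `B` is shrunk to finite positive measure. -/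
theorem exists_indicator_of_volume_ne_zero {B : Set (EuclideanSpace ℝ (Fin d))}
    (hB : MeasurableSet B) (h0 : volume B ≠ 0) :
    ∃ t ⊆ B, MeasurableSet t ∧ volume t ≠ 0 ∧ ∃ f : L2 d,
      (𝓕 f : L2 d) =ᵐ[volume] t.indicator fun _ => (1 : ℂ) := by
  obtain ⟨t, ht, htB, h1, h2⟩ := Measure.exists_subset_measure_lt_top hB (pos_iff_ne_zero.2 h0)
  refine ⟨t, htB, ht, h1.ne', 𝓕⁻ (indicatorConstLp 2 ht h2.ne (1 : ℂ)), ?_⟩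
  rw [FourierTransform.fourier_fourierInv_eq]
  exact indicatorConstLp_coeFn

/-- For an irreducible representation, invariant sets of the dual action are null or conull. -/
theorem volume_eq_zero_or_volume_compl_eq_zero {H : Subgroup (GL (Fin d) ℝ)}
    (hH : IsIrreducibleRep H) {B : Set (EuclideanSpace ℝ (Fin d))} (hB : MeasurableSet B)
    (hinv : ∀ h ∈ H, ∀ ξ ∈ B, dualAct h ξ ∈ B) : volume B = 0 ∨ volume Bᶜ = 0 := by
  have hinv' : ∀ h ∈ H, ∀ ξ ∈ Bᶜ, dualAct h ξ ∈ Bᶜ := fun h hh ξ hξ hξ' => hξ <| by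
    have := hinv h⁻¹ (H.inv_mem hh) _ hξ'
    rwa [← dualAct_mul, mul_inv_cancel, dualAct_one] at this
  have hmem : ∀ f : L2 d, f ∈ fourierVanishing Bᶜ ↔ ∀ᵐ ξ, ξ ∈ Bᶜ → (𝓕 f : L2 d) ξ = 0 := fun f => by
    rw [mem_fourierVanishing, ae_restrict_iff' hB.compl]
  -- The vectors with transform supported in `B` form a closed invariant subspace: if it is trivial,
  -- `B` is null; if it is everything, `Bᶜ` is null.
  rcases hH (fourierVanishing Bᶜ) (isClosed_fourierVanishing _) (fun x h hh f hf => by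
    rw [hmem] at hf ⊢
    filter_upwards [fourier_quasiRegular x h f, (quasiMeasurePreserving_dualAct h).ae hf]
      with ξ h1 h2 hξ
    rw [h1, h2 (hinv' h hh ξ hξ), mul_zero]) with hK | hK
  · left
    by_contra h0
    obtain ⟨t, htB, ht, ht0, f, hf⟩ := exists_indicator_of_volume_ne_zero hB h0
    have hfK : f ∈ fourierVanishing Bᶜ := by
      rw [hmem]
      filter_upwards [hf] with ξ h1 h2
      rw [h1, Set.indicator_of_notMem fun h => h2 (htB h)]
    rw [hK, Submodule.mem_bot] at hfK
    have h2 : (𝓕 f : L2 d) = 0 := by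
      rw [hfK]; exact (Lp.fourierTransformₗᵢ (EuclideanSpace ℝ (Fin d)) ℂ).map_zero
    rw [h2] at hf
    refine ht0 (measure_mono_null (fun ξ hξ => ?_) ((Lp.coeFn_zero ℂ 2 volume).symm.trans hf))
    simp [hξ]
  · right
    by_contra h0
    obtain ⟨t, htB, ht, ht0, f, hf⟩ := exists_indicator_of_volume_ne_zero hB.compl h0
    have hfK : f ∈ fourierVanishing Bᶜ := by rw [hK]; trivial
    rw [hmem] at hfK
    have h2 : ∀ᵐ ξ, ξ ∉ t := by
      filter_upwards [hf, hfK] with ξ h1 h2 h3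
      rw [h2 (htB h3), Set.indicator_of_mem h3] at h1
      exact zero_ne_one h1
    exact ht0 (by simpa [ae_iff] using h2)

end Ergodicity

/-! ### Topology of the general linear group. -/

section Topology

/-- Recording the inverse makes the image closed in a finite-dimensional space, which yields local
compactness, second countability and the Polish property. -/
theorem isClosedEmbedding_val_inv : Topology.IsClosedEmbedding fun g : GL (Fin d) ℝ =>
    ((fun i j => (g : Matrix (Fin d) (Fin d) ℝ) i j,
      fun i j => ((g⁻¹ : GL (Fin d) ℝ) : Matrix (Fin d) (Fin d) ℝ) i j) :
      (Fin d → Fin d → ℝ) × (Fin d → Fin d → ℝ)) :=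
  (((Homeomorph.refl (Matrix (Fin d) (Fin d) ℝ)).prodCongr
    (MulOpposite.opHomeomorph (M := Matrix (Fin d) (Fin d) ℝ)).symm).isClosedEmbedding).comp
    Units.isClosedEmbedding_embedProduct

instance : LocallyCompactSpace (GL (Fin d) ℝ) :=
  isClosedEmbedding_val_inv.locallyCompactSpace

instance : SecondCountableTopology (GL (Fin d) ℝ) :=
  isClosedEmbedding_val_inv.isEmbedding.secondCountableTopology

instance : PolishSpace (GL (Fin d) ℝ) :=
  isClosedEmbedding_val_inv.polishSpace

/-- Needed for unions of orbits: a continuous image of a closed set may fail to be closed, but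
σ-compactness survives. -/
theorem measurableSet_of_isSigmaCompact {X : Type*} [TopologicalSpace X] [T2Space X]
    [MeasurableSpace X] [BorelSpace X] {s : Set X} (hs : IsSigmaCompact s) : MeasurableSet s := by
  obtain ⟨K, hK, rfl⟩ := hs
  exact MeasurableSet.iUnion fun n => (hK n).measurableSet

theorem continuous_dualAct_uncurry :
    Continuous fun p : GL (Fin d) ℝ × EuclideanSpace ℝ (Fin d) => dualAct p.1 p.2 := by
  refine (PiLp.continuous_toLp 2 _).comp (f := fun p : GL (Fin d) ℝ × EuclideanSpace ℝ (Fin d) =>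
    fun j => dualAct p.1 p.2 j) ?_
  refine continuous_pi fun j => ?_
  simp_rw [dualAct_apply]
  refine continuous_finsetSum _ fun i _ => Continuous.mul (by fun_prop) ?_
  exact (Units.continuous_val.comp continuous_fst).matrix_elem i j

end Topology

end ShearletDilation

namespace ShearletDilation

/-! ### Closed connected subgroups of a vector space. -/

section ClosedSubgroups

variable {F : Type*} [NormedAddCommGroup F] [NormedSpace ℝ F]

/-- The largest linear subspace contained in a subgroup. -/
def linearPart (Γ : AddSubgroup F) : Submodule ℝ F where
  carrier := {x | ∀ r : ℝ, r • x ∈ Γ}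
  add_mem' hx hy r := by rw [smul_add]; exact Γ.add_mem (hx r) (hy r)
  zero_mem' r := by rw [smul_zero]; exact Γ.zero_mem
  smul_mem' c x hx r := by rw [smul_smul]; exact hx _

theorem linearPart_le {Γ : AddSubgroup F} {x : F} (hx : x ∈ linearPart Γ) : x ∈ Γ := by
  simpa using hx 1

open Filter Topology in
-- The multiples `⌊r / ‖w n‖⌋ • w n` lie in `Γ` and tend to `r • v`, because the rounding error is
-- at most `‖w n‖`.
theorem mem_linearPart_of_tendsto {Γ : AddSubgroup F} (hΓ : IsClosed (Γ : Set F)) {w : ℕ → F}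
    (hw : ∀ n, w n ∈ Γ) (hw0 : ∀ n, w n ≠ 0) (hlim : Tendsto (fun n => ‖w n‖) atTop (𝓝 0)) {v : F}
    (hv : Tendsto (fun n => ‖w n‖⁻¹ • w n) atTop (𝓝 v)) : v ∈ linearPart Γ := by
  intro r
  have h1 : Tendsto (fun n => (⌊r / ‖w n‖⌋ : ℝ) * ‖w n‖) atTop (𝓝 r) := by
    have h2 : Tendsto (fun n => r - ‖w n‖) atTop (𝓝 r) := by simpa using hlim.const_sub r
    refine tendsto_of_tendsto_of_tendsto_of_le_of_le h2 tendsto_const_nhds (fun n => ?_) fun n => ?_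
    · have hp : 0 < ‖w n‖ := norm_pos_iff.2 (hw0 n)
      have := (Int.sub_one_lt_floor (r / ‖w n‖)).le
      have h3 := mul_le_mul_of_nonneg_right this hp.le
      rwa [sub_mul, div_mul_cancel₀ _ hp.ne', one_mul] at h3
    · have hp : 0 < ‖w n‖ := norm_pos_iff.2 (hw0 n)
      have h3 := mul_le_mul_of_nonneg_right (Int.floor_le (r / ‖w n‖)) hp.le
      rwa [div_mul_cancel₀ _ hp.ne'] at h3
  refine hΓ.mem_of_tendsto (h1.smul hv) (Eventually.of_forall fun n => ?_)
  have hp : ‖w n‖ ≠ 0 := norm_ne_zero_iff.2 (hw0 n)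
  change _ ∈ Γ
  rw [smul_smul, mul_assoc, mul_inv_cancel₀ hp, mul_one, Int.cast_smul_eq_zsmul]
  exact Γ.zsmul_mem (hw n) _

open Filter Topology in
-- Otherwise small nonzero elements of `Γ ∩ W`, normalised, would accumulate at a unit vector lying
-- in both `W` and the linear part.
theorem exists_ball_inter_eq_zero [FiniteDimensional ℝ F] {Γ : AddSubgroup F} (hΓ : IsClosed (Γ : Set F))
    {W : Submodule ℝ F} (hW : Disjoint (linearPart Γ) W) :
    ∃ ε > 0, ∀ x ∈ Γ, x ∈ W → ‖x‖ < ε → x = 0 := by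
  by_contra! hcon
  choose w hw hwW hwn hw0 using fun n : ℕ => hcon (1 / ((n : ℝ) + 1)) Nat.one_div_pos_of_nat
  have hlim : Tendsto (fun n => ‖w n‖) atTop (𝓝 0) :=
    squeeze_zero (fun n => norm_nonneg _) (fun n => (hwn n).le) tendsto_one_div_add_atTop_nhds_zero_nat
  have hs : ∀ n, ‖w n‖⁻¹ • w n ∈ Metric.sphere (0 : F) 1 := fun n => by
    simp [norm_smul, hw0 n]
  obtain ⟨v, hv, φ, hφ, hφv⟩ := (isCompact_sphere (0 : F) 1).tendsto_subseq hs
  have h1 : v ∈ linearPart Γ := mem_linearPart_of_tendsto hΓ (w := w ∘ φ) (fun n => hw _)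
    (fun n => hw0 _) (hlim.comp hφ.tendsto_atTop) hφv
  have h2 : v ∈ W := W.closed_of_finiteDimensional.mem_of_tendsto hφv
    (Eventually.of_forall fun n => W.smul_mem _ (hwW _))
  have h3 : v = 0 := Submodule.disjoint_def.1 hW v h1 h2
  simp [h3] at hv

/-- A closed connected subgroup of a finite-dimensional real vector space is a linear subspace. -/
theorem smul_mem_of_isClosed_of_isPreconnected [FiniteDimensional ℝ F] {Γ : AddSubgroup F} (hΓ : IsClosed (Γ : Set F))
    (hc : IsPreconnected (Γ : Set F)) {x : F} (hx : x ∈ Γ) (r : ℝ) : r • x ∈ Γ := by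
  obtain ⟨W, hW⟩ := (linearPart Γ).exists_isCompl
  obtain ⟨ε, hε, hball⟩ := exists_ball_inter_eq_zero hΓ hW.disjoint
  set P := W.projectionOnto (linearPart Γ) hW.symm with hP
  have hPc : Continuous fun y => (P y : F) :=
    (W.subtype.comp P).continuous_of_finiteDimensional
  have hsub : ∀ y, y - P y ∈ linearPart Γ := fun y => by
    rw [← Submodule.ker_projectionOnto hW.symm, LinearMap.mem_ker, ← hP, map_sub,
      Submodule.projectionOnto_apply_left hW.symm (P y), sub_self]
  have hPΓ : ∀ y ∈ Γ, (P y : F) ∈ Γ := fun y hy => by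
    simpa using Γ.sub_mem hy (linearPart_le (hsub y))
  suffices h0 : (P x : F) = 0 by simpa [h0] using hsub x r
  by_contra h0
  -- The projection of `Γ` to `W` is connected and contained in `Γ ∩ W`, where zero is isolated; a
  -- nonzero value would disconnect it.
  obtain ⟨z, ⟨y, hy, rfl⟩, hz1, hz2⟩ := (hc.image _ hPc.continuousOn) (Metric.ball 0 ε) {0}ᶜ
    Metric.isOpen_ball isOpen_compl_singleton
    (fun z _ => by by_cases hz : z = 0 <;> simp [hz, hε])
    ⟨0, ⟨0, Γ.zero_mem, by simp⟩, by simpa using hε⟩ ⟨P x, ⟨x, hx, rfl⟩, h0⟩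
  exact hz2 (hball _ (hPΓ y hy) (P y).2 (by simpa using hz1))

end ClosedSubgroups

/-! ### Exponential and logarithm of nilpotent elements. -/

section NilpotentLog

open Finset

variable {A : Type*} [NormedRing A] [NormedAlgebra ℝ A] [CompleteSpace A]

/-- The polynomial `∑_{m < N} (-1)ᵐ nᵐ⁺¹ / (m + 1)`, the logarithm of `1 + n` if `nᴺ = 0`. -/
noncomputable def logPoly {A : Type*} [Ring A] [Algebra ℝ A] (N : ℕ) (n : A) : A :=
  ∑ m ∈ range N, ((-1 : ℝ) ^ m / (m + 1)) • n ^ (m + 1)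

theorem commute_logPoly {A : Type*} [Ring A] [Algebra ℝ A] (N : ℕ) {a n : A} (h : Commute a n) :
    Commute a (logPoly N n) :=
  Commute.sum_right _ _ _ fun _ _ => (h.pow_right _).smul_right _

/-- Commutation gives `exp (Y s) = exp (Y t) * exp (Y s - Y t)`, so only the derivative of `exp` at
zero enters. -/
theorem hasDerivAt_exp_of_commute {Y : ℝ → A} {Y' : A} {t : ℝ} (hY : HasDerivAt Y Y' t)
    (hc : ∀ s, Commute (Y t) (Y s)) :
    HasDerivAt (fun s => NormedSpace.exp (Y s)) (NormedSpace.exp (Y t) * Y') t := by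
  let _ : NormedAlgebra ℚ A := NormedAlgebra.restrictScalars ℚ ℝ A
  have h1 : (fun s => NormedSpace.exp (Y s)) =
      fun s => NormedSpace.exp (Y t) * NormedSpace.exp (Y s - Y t) := by
    ext s
    rw [← NormedSpace.exp_add_of_commute ((hc s).sub_right (Commute.refl _)), add_sub_cancel]
  rw [h1]
  have h2 : HasFDerivAt (NormedSpace.exp : A → A) (1 : A →L[ℝ] A) (Y t - Y t) := by
    rw [sub_self]; exact hasFDerivAt_exp_zero
  exact (h2.comp_hasDerivAt t (hY.sub_const (Y t))).const_mul _

/-- With `Y t = log (1 + t n)`, the function `exp (-Y t) * (1 + t n)` has derivative zero, since a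
finite geometric sum gives `Y' t * (1 + t n) = n`. Its values at 0 and 1 are compared. -/
theorem exp_logPoly {N : ℕ} {n : A} (hn : n ^ N = 0) : NormedSpace.exp (logPoly N n) = 1 + n := by
  let _ : NormedAlgebra ℚ A := NormedAlgebra.restrictScalars ℚ ℝ A
  set Y : ℝ → A := fun t => logPoly N (t • n) with hY
  set Y' : ℝ → A := fun t => ∑ m ∈ range N, (-t • n) ^ m * n with hY'
  have hcn : ∀ t, Commute n (Y t) := fun t => commute_logPoly N ((Commute.refl n).smul_right t)
  have hcY : ∀ s t, Commute (Y s) (Y t) := fun s t =>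
    commute_logPoly N (((hcn s).symm).smul_right t)
  have hd : ∀ t, HasDerivAt Y (Y' t) t := fun t => by
    have h1 : Y = fun t => ∑ m ∈ range N, (t ^ (m + 1)) • (((-1 : ℝ) ^ m / (m + 1)) • n ^ (m + 1)) := by
      ext t
      refine sum_congr rfl fun m _ => ?_
      rw [smul_pow, smul_comm]
    rw [h1]
    refine (HasDerivAt.fun_sum fun m _ => ((hasDerivAt_pow (m + 1) t).smul_const _)).congr_deriv ?_
    refine sum_congr rfl fun m _ => ?_
    rw [smul_pow, smul_mul_assoc, ← pow_succ, smul_smul]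
    congr 1
    push_cast
    have : (m : ℝ) + 1 ≠ 0 := by positivity
    field_simp
    rw [neg_pow t, mul_comm]
  have hY1 : ∀ t, Y' t * (1 + t • n) = n := fun t => by
    have h1 : Y' t = n * ∑ m ∈ range N, (-t • n) ^ m := by
      rw [mul_sum]
      exact sum_congr rfl fun m _ => (((Commute.refl n).smul_right (-t)).pow_right m).eq.symm
    have h2 : (∑ m ∈ range N, (-t • n) ^ m) * (1 + t • n) = 1 := by
      have := geom_sum_mul_neg (-t • n) N
      rw [smul_pow, hn] at this
      simpa using this
    rw [h1, mul_assoc, h2, mul_one]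
  have hφ : ∀ t, HasDerivAt (fun t => NormedSpace.exp (-Y t) * (1 + t • n)) 0 t := fun t => by
    have e1 := hasDerivAt_exp_of_commute (hd t).neg (fun s => ((hcY t s).neg_left).neg_right)
    have e2 : HasDerivAt (fun t : ℝ => 1 + t • n) n t := by
      simpa using ((hasDerivAt_id t).smul_const n).const_add 1
    refine (e1.mul e2).congr_deriv ?_
    rw [mul_assoc]
    simp [hY1]
  have hconst := is_const_of_deriv_eq_zero (fun t => (hφ t).differentiableAt)
    (fun t => (hφ t).deriv) 1 0
  have hY0 : Y 0 = 0 := by simp [hY, logPoly]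
  simp only [hY0, neg_zero, NormedSpace.exp_zero, zero_smul, add_zero, mul_one, one_smul] at hconst
  have hY1' : Y 1 = logPoly N n := by simp [hY]
  rw [← hY1']
  calc NormedSpace.exp (Y 1) = NormedSpace.exp (Y 1) * (NormedSpace.exp (-Y 1) * (1 + n)) := by
        rw [hconst, mul_one]
    _ = 1 + n := by
        rw [← mul_assoc, ← NormedSpace.exp_add_of_commute (Commute.refl _).neg_right]
        simp

omit [CompleteSpace A] in
theorem exp_eq_sum_of_pow_eq_zero {N : ℕ} {n : A} (hn : n ^ N = 0) :
    NormedSpace.exp n = ∑ j ∈ range N, ((j.factorial : ℝ)⁻¹) • n ^ j := by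
  rw [NormedSpace.exp_eq_tsum ℝ]
  refine tsum_eq_sum fun j hj => ?_
  rw [pow_eq_zero_of_le (by simpa using hj) hn, smul_zero]

omit [CompleteSpace A] in
-- The nilpotency order drops: if `n ^ (N + 2) = 0`, multiplying `exp n = 1` by `n ^ N` leaves `n ^
-- (N + 1) = 0`.
theorem eq_zero_of_exp_eq_one {N : ℕ} {n : A} (hn : n ^ N = 0) (h : NormedSpace.exp n = 1) :
    n = 0 := by
  induction N with
  | zero => simpa using congrArg (· * n) hn
  | succ N ih =>
    rcases N with _ | N
    · simpa using hn
    refine ih ?_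
    have h1 : n ^ N * NormedSpace.exp n = n ^ N + n ^ (N + 1) := by
      rw [exp_eq_sum_of_pow_eq_zero hn, sum_range_succ', sum_range_succ', mul_add, mul_add,
        mul_sum, sum_eq_zero]
      · simp [pow_succ, add_comm]
      · intro j _
        rw [mul_smul_comm, ← pow_add, pow_eq_zero_of_le (by omega) hn, smul_zero]
    rw [h, mul_one] at h1
    simpa using h1

/-- The logarithm `Z` of `exp n` is nilpotent and commutes with `n`, so `exp (Z - n) = 1` with `Z -
n` nilpotent. -/
theorem logPoly_exp_sub_one {N : ℕ} {n : A} (hn : n ^ N = 0)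
    (he : (NormedSpace.exp n - 1) ^ N = 0) : logPoly N (NormedSpace.exp n - 1) = n := by
  let _ : NormedAlgebra ℚ A := NormedAlgebra.restrictScalars ℚ ℝ A
  set Z := logPoly N (NormedSpace.exp n - 1) with hZ
  have h1 : NormedSpace.exp Z = NormedSpace.exp n := by rw [hZ, exp_logPoly he]; simp
  have hc0 : Commute n (NormedSpace.exp n - 1) :=
    ((Commute.refl n).exp_right).sub_right (Commute.one_right n)
  have hc : Commute Z n := (commute_logPoly N hc0).symm
  have hZn : IsNilpotent Z := by
    rw [hZ, logPoly]
    exact Commute.isNilpotent_sum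
      (fun m _ => (IsNilpotent.pow_of_pos ⟨N, he⟩ m.succ_ne_zero).smul _)
      fun i j _ _ => (((Commute.refl _).pow_pow _ _).smul_left _).smul_right _
  obtain ⟨M, hM⟩ : IsNilpotent (Z - n) := hc.isNilpotent_sub hZn ⟨N, hn⟩
  refine sub_eq_zero.1 (eq_zero_of_exp_eq_one hM ?_)
  rw [sub_eq_add_neg, NormedSpace.exp_add_of_commute hc.neg_right, h1,
    ← NormedSpace.exp_add_of_commute (Commute.refl n).neg_right, add_neg_cancel,
    NormedSpace.exp_zero]

end NilpotentLog

end ShearletDilation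

namespace ShearletDilation

/-! ### Real powers in commutative unipotent matrix groups. -/

section Unipotent

variable {d : ℕ}

/-- Strictly upper triangular matrices. -/
def strictUpper (d : ℕ) : Submodule ℝ (Matrix (Fin d) (Fin d) ℝ) where
  carrier := {X | ∀ i j, j ≤ i → X i j = 0}
  add_mem' hX hY i j hij := by simp [hX i j hij, hY i j hij]
  zero_mem' i j _ := rfl
  smul_mem' c X hX i j hij := by simp [hX i j hij]

theorem mul_mem_strictUpper {X Y : Matrix (Fin d) (Fin d) ℝ} (hX : X ∈ strictUpper d)
    (hY : Y ∈ strictUpper d) : X * Y ∈ strictUpper d := by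
  intro i j hij
  rw [Matrix.mul_apply]
  refine Finset.sum_eq_zero fun l _ => ?_
  rcases le_or_gt l i with h | h
  · rw [hX i l h, zero_mul]
  · rw [hY l j (hij.trans h.le), mul_zero]

theorem pow_succ_mem_strictUpper {X : Matrix (Fin d) (Fin d) ℝ} (hX : X ∈ strictUpper d) (m : ℕ) :
    X ^ (m + 1) ∈ strictUpper d := by
  induction m with
  | zero => simpa using hX
  | succ m ih => rw [pow_succ]; exact mul_mem_strictUpper ih hX

/-- Cayley–Hamilton: the characteristic polynomial is the `d`-th power of the variable. -/
theorem pow_eq_zero_of_mem_strictUpper {X : Matrix (Fin d) (Fin d) ℝ} (hX : X ∈ strictUpper d) :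
    X ^ d = 0 := by
  have h1 : X.BlockTriangular id := fun i j hij => hX i j (le_of_lt hij)
  have h2 := Matrix.aeval_self_charpoly X
  rw [Matrix.charpoly_of_isUpperTriangular X h1] at h2
  simpa [hX _ _ le_rfl] using h2

theorem isUpperUnipotent_iff {A : Matrix (Fin d) (Fin d) ℝ} :
    IsUpperUnipotent A ↔ A - 1 ∈ strictUpper d := by
  constructor
  · rintro ⟨h1, h2⟩ i j hij
    rcases hij.lt_or_eq with h | rfl
    · simp [h1 i j h, Matrix.one_apply_ne h.ne']
    · simp [h2]
  · intro h
    refine ⟨fun i j hij => ?_, fun i => ?_⟩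
    · simpa [Matrix.one_apply_ne hij.ne'] using h i j hij.le
    · simpa [sub_eq_zero] using h i i le_rfl

theorem logPoly_mem_strictUpper {X : Matrix (Fin d) (Fin d) ℝ} (hX : X ∈ strictUpper d) :
    logPoly d X ∈ strictUpper d :=
  Submodule.sum_mem _ fun m _ => Submodule.smul_mem _ _ (pow_succ_mem_strictUpper hX m)

theorem matrix_exp_eq_sum {X : Matrix (Fin d) (Fin d) ℝ} (hX : X ∈ strictUpper d) :
    NormedSpace.exp X = 1 + ∑ j ∈ Finset.range d, (((j + 1).factorial : ℝ)⁻¹) • X ^ (j + 1) := by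
  let _ : NormedRing (Matrix (Fin d) (Fin d) ℝ) := Matrix.linftyOpNormedRing
  let _ : NormedAlgebra ℝ (Matrix (Fin d) (Fin d) ℝ) := Matrix.linftyOpNormedAlgebra
  -- The exponent is `d + 1` so that splitting off the constant term leaves a sum over `range d`.
  have h : X ^ (d + 1) = 0 := by rw [pow_succ, pow_eq_zero_of_mem_strictUpper hX, zero_mul]
  refine (exp_eq_sum_of_pow_eq_zero h).trans ?_
  rw [Finset.sum_range_succ', add_comm]
  simp

theorem exp_sub_one_mem_strictUpper {X : Matrix (Fin d) (Fin d) ℝ} (hX : X ∈ strictUpper d) :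
    NormedSpace.exp X - 1 ∈ strictUpper d := by
  rw [matrix_exp_eq_sum hX, add_sub_cancel_left]
  exact Submodule.sum_mem _ fun m _ => Submodule.smul_mem _ _ (pow_succ_mem_strictUpper hX m)

theorem matrix_exp_logPoly {X : Matrix (Fin d) (Fin d) ℝ} (hX : X ∈ strictUpper d) :
    NormedSpace.exp (logPoly d X) = 1 + X := by
  let _ : NormedRing (Matrix (Fin d) (Fin d) ℝ) := Matrix.linftyOpNormedRing
  let _ : NormedAlgebra ℝ (Matrix (Fin d) (Fin d) ℝ) := Matrix.linftyOpNormedAlgebra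
  exact exp_logPoly (pow_eq_zero_of_mem_strictUpper hX)

theorem logPoly_matrix_exp_sub_one {X : Matrix (Fin d) (Fin d) ℝ} (hX : X ∈ strictUpper d) :
    logPoly d (NormedSpace.exp X - 1) = X := by
  let _ : NormedRing (Matrix (Fin d) (Fin d) ℝ) := Matrix.linftyOpNormedRing
  let _ : NormedAlgebra ℝ (Matrix (Fin d) (Fin d) ℝ) := Matrix.linftyOpNormedAlgebra
  exact logPoly_exp_sub_one (pow_eq_zero_of_mem_strictUpper hX)
    (pow_eq_zero_of_mem_strictUpper (exp_sub_one_mem_strictUpper hX))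

theorem matrix_exp_mul_exp_neg (X : Matrix (Fin d) (Fin d) ℝ) :
    NormedSpace.exp X * NormedSpace.exp (-X) = 1 := by
  rw [← Matrix.exp_add_of_commute _ _ (Commute.refl X).neg_right, add_neg_cancel,
    NormedSpace.exp_zero]

/-- The matrix exponential with values in `GL(d, ℝ)`. -/
noncomputable def expGL (X : Matrix (Fin d) (Fin d) ℝ) : GL (Fin d) ℝ where
  val := NormedSpace.exp X
  inv := NormedSpace.exp (-X)
  val_inv := matrix_exp_mul_exp_neg X
  inv_val := by simpa using matrix_exp_mul_exp_neg (-X)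

theorem continuous_expGL : Continuous (expGL (d := d)) := by
  let _ : NormedRing (Matrix (Fin d) (Fin d) ℝ) := Matrix.linftyOpNormedRing
  let _ : NormedAlgebra ℝ (Matrix (Fin d) (Fin d) ℝ) := Matrix.linftyOpNormedAlgebra
  let _ : NormedAlgebra ℚ (Matrix (Fin d) (Fin d) ℝ) := NormedAlgebra.restrictScalars ℚ ℝ _
  have h : Continuous (NormedSpace.exp : Matrix (Fin d) (Fin d) ℝ → _) := NormedSpace.exp_continuous
  exact Units.continuous_iff.2 ⟨h, h.comp continuous_neg⟩

/-- The logarithms of the elements of a commutative group of unipotent matrices. -/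
noncomputable def logSubgroup (S : Subgroup (GL (Fin d) ℝ)) (hS : ∀ s ∈ S, ∀ t ∈ S, s * t = t * s) :
    AddSubgroup (Matrix (Fin d) (Fin d) ℝ) where
  carrier := {X | X ∈ strictUpper d ∧ expGL X ∈ S}
  zero_mem' := by
    refine ⟨Submodule.zero_mem _, ?_⟩
    have : expGL (0 : Matrix (Fin d) (Fin d) ℝ) = 1 := Units.ext NormedSpace.exp_zero
    rw [this]; exact S.one_mem
  add_mem' {X Y} hX hY := by
    refine ⟨Submodule.add_mem _ hX.1 hY.1, ?_⟩
    -- Logarithms are polynomials in the group elements, so commuting exponentials have commuting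
    -- logarithms and `exp (X + Y)` factors.
    have h1 : Commute (NormedSpace.exp X - 1) (NormedSpace.exp Y - 1) := by
      have : Commute (NormedSpace.exp X) (NormedSpace.exp Y) :=
        congrArg Units.val (hS _ hX.2 _ hY.2)
      exact (this.sub_left (Commute.one_left _)).sub_right (Commute.one_right _)
    have h2 := (commute_logPoly d (commute_logPoly d h1).symm).symm
    rw [logPoly_matrix_exp_sub_one hX.1, logPoly_matrix_exp_sub_one hY.1] at h2
    have h3 : expGL (X + Y) = expGL X * expGL Y := Units.ext (Matrix.exp_add_of_commute _ _ h2)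
    rw [h3]; exact S.mul_mem hX.2 hY.2
  neg_mem' {X} hX := by
    refine ⟨Submodule.neg_mem _ hX.1, ?_⟩
    have : expGL (-X) = (expGL X)⁻¹ := Units.ext rfl
    rw [this]; exact S.inv_mem hX.2

theorem isClosed_strictUpper : IsClosed (strictUpper d : Set (Matrix (Fin d) (Fin d) ℝ)) := by
  have : (strictUpper d : Set (Matrix (Fin d) (Fin d) ℝ)) =
      ⋂ i, ⋂ j, {X | j ≤ i → X i j = 0} := by
    ext X
    simp only [Set.mem_iInter]
    exact Iff.rfl
  rw [this]
  refine isClosed_iInter fun i => isClosed_iInter fun j => ?_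
  by_cases hij : j ≤ i
  · simpa [hij] using isClosed_eq (continuous_id.matrix_elem i j) continuous_const
  · simp [hij]

/-- A closed connected commutative group of unipotent matrices is closed under real powers. -/
theorem expGL_smul_logPoly_mem {S : Subgroup (GL (Fin d) ℝ)} (hcl : IsClosed (S : Set (GL (Fin d) ℝ)))
    (hconn : IsConnected (S : Set (GL (Fin d) ℝ))) (hS : ∀ s ∈ S, ∀ t ∈ S, s * t = t * s)
    (hU : ∀ s ∈ S, IsUpperUnipotent (s : Matrix (Fin d) (Fin d) ℝ)) {s : GL (Fin d) ℝ} (hs : s ∈ S)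
    (r : ℝ) : expGL (r • logPoly d ((s : Matrix (Fin d) (Fin d) ℝ) - 1)) ∈ S := by
  have hlog : ∀ s ∈ S, logPoly d ((s : Matrix (Fin d) (Fin d) ℝ) - 1) ∈ logSubgroup S hS := by
    intro s hs
    have h1 := isUpperUnipotent_iff.1 (hU s hs)
    refine ⟨logPoly_mem_strictUpper h1, ?_⟩
    have : expGL (logPoly d ((s : Matrix (Fin d) (Fin d) ℝ) - 1)) = s :=
      Units.ext ((matrix_exp_logPoly h1).trans (by simp))
    rwa [this]
  -- Connectedness of the set of logarithms comes from a continuous image under `log`, closedness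
  -- from a preimage under `exp`.
  have himage : (logSubgroup S hS : Set (Matrix (Fin d) (Fin d) ℝ)) =
      (fun s : GL (Fin d) ℝ => logPoly d ((s : Matrix (Fin d) (Fin d) ℝ) - 1)) '' S := by
    ext X
    constructor
    · rintro ⟨h1, h2⟩
      exact ⟨_, h2, logPoly_matrix_exp_sub_one h1⟩
    · rintro ⟨s, hs, rfl⟩
      exact hlog s hs
  have hcont : Continuous fun s : GL (Fin d) ℝ => logPoly d ((s : Matrix (Fin d) (Fin d) ℝ) - 1) := by
    unfold logPoly
    exact continuous_finsetSum _ fun m _ => (continuous_const_smul _).comp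
      ((Units.continuous_val.sub continuous_const).pow _)
  have hc : IsPreconnected (logSubgroup S hS : Set (Matrix (Fin d) (Fin d) ℝ)) := by
    rw [himage]; exact hconn.isPreconnected.image _ hcont.continuousOn
  have hΓ : IsClosed (logSubgroup S hS : Set (Matrix (Fin d) (Fin d) ℝ)) :=
    isClosed_strictUpper.inter (hcl.preimage continuous_expGL)
  let _ : NormedRing (Matrix (Fin d) (Fin d) ℝ) := Matrix.linftyOpNormedRing
  let _ : NormedAlgebra ℝ (Matrix (Fin d) (Fin d) ℝ) := Matrix.linftyOpNormedAlgebra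
  exact (smul_mem_of_isClosed_of_isPreconnected hΓ hc (hlog s hs) r).2

end Unipotent

end ShearletDilation

namespace ShearletDilation

/-! ### Diagonal part, shearing part and first rows. -/

variable {d : ℕ}

local notation "𝕄" => Matrix (Fin d) (Fin d) ℝ

/-- The diagonal matrix with entries `exp (r yᵢ)`. -/
noncomputable def diagGL (y : Fin d → ℝ) (r : ℝ) : GL (Fin d) ℝ where
  val := Matrix.diagonal fun i => Real.exp (r * y i)
  inv := Matrix.diagonal fun i => Real.exp (-r * y i)
  val_inv := by rw [Matrix.diagonal_mul_diagonal, ← Matrix.diagonal_one]; simp [← Real.exp_add]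
  inv_val := by rw [Matrix.diagonal_mul_diagonal, ← Matrix.diagonal_one]; simp [← Real.exp_add]

theorem val_diagGL (y : Fin d → ℝ) (r : ℝ) :
    (diagGL y r : 𝕄) = Matrix.diagonal fun i => Real.exp (r * y i) := rfl

theorem matrix_exp_smul_diagonal (y : Fin d → ℝ) (r : ℝ) :
    NormedSpace.exp (r • Matrix.diagonal y) = (diagGL y r : 𝕄) := by
  rw [← Matrix.diagonal_smul, Matrix.exp_diagonal, val_diagGL]
  congr 1
  ext i
  rw [Pi.coe_exp, ← Real.exp_eq_exp_ℝ]
  simp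

/-- The shearing and diagonal parts of a generalized shearlet dilation group. -/
structure IsShearletDecomposition (H S : Subgroup (GL (Fin d) ℝ)) (y : Fin d → ℝ) : Prop where
  le : S ≤ H
  isClosed : IsClosed (S : Set (GL (Fin d) ℝ))
  isConnected : IsConnected (S : Set (GL (Fin d) ℝ))
  comm : ∀ s ∈ S, ∀ t ∈ S, s * t = t * s
  unipotent : ∀ s ∈ S, IsUpperUnipotent (s : 𝕄)
  diag_mem : ∀ r, diagGL y r ∈ H
  exists_eq : ∀ h ∈ H, ∃ (ε : ℤˣ) (r : ℝ), ∃ s ∈ S,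
    (h : 𝕄) = ((ε : ℤ) : ℝ) • ((diagGL y r : 𝕄) * (s : 𝕄))

theorem IsGeneralizedShearletGroup.exists_decomposition {H : Subgroup (GL (Fin d) ℝ)}
    (hH : IsGeneralizedShearletGroup H) : ∃ S y, IsShearletDecomposition H S y := by
  obtain ⟨S, D, hS, hD, ⟨h1, h2, h3, h4⟩, ⟨-, y, hy⟩, h5⟩ := hH.exists_shearing_diagonal
  refine ⟨S, y, hS, h1, h2, h3, h4, fun r => hD ((hy _).2 ⟨r, (matrix_exp_smul_diagonal y r).symm⟩),
    fun h hh => ?_⟩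
  obtain ⟨⟨ε, a, s⟩, hp, -⟩ := h5 h hh
  obtain ⟨r, hr⟩ := (hy a).1 a.2
  refine ⟨ε, r, s, s.2, ?_⟩
  rw [hp, Units.val_mul, hr, matrix_exp_smul_diagonal]

section RowLemmas

variable [NeZero d]

omit [NeZero d] in
theorem volume_coord_eq_zero (i : Fin d) :
    volume {ξ : EuclideanSpace ℝ (Fin d) | ξ i = 0} = 0 := by
  have h := Measure.addHaar_submodule (volume : Measure (EuclideanSpace ℝ (Fin d)))
    (LinearMap.ker (EuclideanSpace.proj i : EuclideanSpace ℝ (Fin d) →L[ℝ] ℝ).toLinearMap) (by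
      intro h
      have : EuclideanSpace.single i (1 : ℝ) ∈
        LinearMap.ker (EuclideanSpace.proj i : EuclideanSpace ℝ (Fin d) →L[ℝ] ℝ).toLinearMap := by
        rw [h]; trivial
      simp at this)
  exact h

/-- Right multiplication by a strictly upper triangular matrix shifts the first nonzero entry of a
row to the right. Hence up to column `k` only the linear terms of `log` and `exp` affect the first
row. -/
theorem strictUpper_mul_row_eq_zero {k : ℕ} {X Y : 𝕄} (hY : Y ∈ strictUpper d)
    (h0 : ∀ l : Fin d, l.val < k → X 0 l = 0) (j : Fin d) (hj : j.val ≤ k) : (X * Y) 0 j = 0 := by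
  rw [Matrix.mul_apply]
  refine Finset.sum_eq_zero fun l _ => ?_
  rcases lt_or_ge l.val k with h | h
  · rw [h0 l h, zero_mul]
  · rw [hY l j (Fin.le_def.2 (hj.trans h)), mul_zero]

theorem pow_row_eq_zero {k : ℕ} {X : 𝕄} (hX : X ∈ strictUpper d)
    (h0 : ∀ l : Fin d, l.val < k → X 0 l = 0) (m : ℕ) (j : Fin d) (hj : j.val ≤ k) :
    (X ^ (m + 1 + 1)) 0 j = 0 := by
  rw [pow_succ']
  exact strictUpper_mul_row_eq_zero (pow_succ_mem_strictUpper hX m) h0 j hj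

theorem logPoly_row {k : ℕ} {X : 𝕄} (hX : X ∈ strictUpper d)
    (h0 : ∀ l : Fin d, l.val < k → X 0 l = 0) (j : Fin d) (hj : j.val ≤ k) :
    logPoly d X 0 j = X 0 j := by
  obtain ⟨n, rfl⟩ : ∃ n, d = n + 1 := Nat.exists_eq_succ_of_ne_zero (NeZero.ne d)
  rw [logPoly, Matrix.sum_apply, Finset.sum_range_succ', Finset.sum_eq_zero]
  · simp
  · intro m _
    rw [Matrix.smul_apply, pow_row_eq_zero hX h0 m j hj, smul_zero]

theorem matrix_exp_row {k : ℕ} {X : 𝕄} (hX : X ∈ strictUpper d)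
    (h0 : ∀ l : Fin d, l.val < k → X 0 l = 0) (j : Fin d) (hj : j.val ≤ k) :
    NormedSpace.exp X 0 j = (1 : 𝕄) 0 j + X 0 j := by
  rw [matrix_exp_eq_sum hX, Matrix.add_apply, Matrix.sum_apply]
  obtain ⟨n, rfl⟩ : ∃ n, d = n + 1 := Nat.exists_eq_succ_of_ne_zero (NeZero.ne d)
  rw [Finset.sum_range_succ', Finset.sum_eq_zero]
  · simp
  · intro m _
    rw [Matrix.smul_apply, pow_row_eq_zero hX h0 m j hj, smul_zero]

end RowLemmas

namespace IsShearletDecomposition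

variable {H S : Subgroup (GL (Fin d) ℝ)} {y : Fin d → ℝ}

theorem apply_eq_zero_of_mem_shear (hD : IsShearletDecomposition H S y) {s : GL (Fin d) ℝ}
    (hs : s ∈ S) {i j : Fin d} (hij : j < i) : (s : 𝕄) i j = 0 :=
  (hD.unipotent s hs).1 i j hij

theorem apply_self_of_mem_shear (hD : IsShearletDecomposition H S y) {s : GL (Fin d) ℝ}
    (hs : s ∈ S) (i : Fin d) : (s : 𝕄) i i = 1 :=
  (hD.unipotent s hs).2 i

theorem apply_eq_zero (hD : IsShearletDecomposition H S y) {h : GL (Fin d) ℝ}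
    (hh : h ∈ H) {i j : Fin d} (hij : j < i) : (h : 𝕄) i j = 0 := by
  obtain ⟨ε, r, s, hs, e⟩ := hD.exists_eq h hh
  rw [e, val_diagGL, Matrix.smul_apply, Matrix.diagonal_mul, hD.apply_eq_zero_of_mem_shear hs hij]
  simp

theorem apply_self_ne_zero (hD : IsShearletDecomposition H S y) {h : GL (Fin d) ℝ}
    (hh : h ∈ H) (i : Fin d) : (h : 𝕄) i i ≠ 0 := by
  obtain ⟨ε, r, s, hs, e⟩ := hD.exists_eq h hh
  rw [e, val_diagGL, Matrix.smul_apply, Matrix.diagonal_mul, hD.apply_self_of_mem_shear hs]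
  rcases Int.units_eq_one_or ε with rfl | rfl <;> simp [Real.exp_ne_zero]

variable [NeZero d]

theorem dualAct_apply_zero (hD : IsShearletDecomposition H S y) {h : GL (Fin d) ℝ} (hh : h ∈ H)
    (ξ : EuclideanSpace ℝ (Fin d)) : dualAct h ξ 0 = ξ 0 * (h : 𝕄) 0 0 := by
  rw [dualAct_apply]
  refine Finset.sum_eq_single _ (fun i _ hi => ?_) (by simp)
  rw [hD.apply_eq_zero hh (Fin.pos_iff_ne_zero.2 hi), mul_zero]

/-- Otherwise `|ξ 0|` is invariant, and the slab `|ξ 0| < 1` is neither null nor conull. -/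
theorem exponent_ne_zero (hD : IsShearletDecomposition H S y) (hH : IsIrreducibleRep H) :
    y 0 ≠ 0 := by
  intro hy
  have hc : Continuous fun ξ : EuclideanSpace ℝ (Fin d) => ξ 0 := by fun_prop
  rcases volume_eq_zero_or_volume_compl_eq_zero hH
    (B := {ξ | |ξ 0| < 1}) (isOpen_lt hc.abs continuous_const).measurableSet (fun h hh ξ hξ => by
      obtain ⟨ε, r, s, hs, e⟩ := hD.exists_eq h hh
      have h1 : |(h : 𝕄) 0 0| = 1 := by
        rw [e, val_diagGL, Matrix.smul_apply, Matrix.diagonal_mul, hD.apply_self_of_mem_shear hs, hy]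
        rcases Int.units_eq_one_or ε with rfl | rfl <;> simp
      simpa [hD.dualAct_apply_zero hh, abs_mul, h1] using hξ) with h | h
  · exact (isOpen_lt hc.abs continuous_const).measure_ne_zero volume ⟨0, by simp⟩ h
  · refine (isOpen_lt continuous_const hc : IsOpen {ξ : EuclideanSpace ℝ (Fin d) | 1 < ξ 0}).measure_ne_zero
      volume ⟨EuclideanSpace.single 0 2, by simp⟩ (measure_mono_null (fun ξ hξ => ?_) h)
    simp only [Set.mem_compl_iff, Set.mem_ofPred_eq, not_lt] at hξ ⊢
    exact hξ.le.trans (le_abs_self _)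

/-- Without `-1` every leading entry would be positive, so the half-space `0 < ξ 0` would be
invariant. -/
theorem neg_one_mem (hD : IsShearletDecomposition H S y) (hH : IsIrreducibleRep H) :
    (-1 : GL (Fin d) ℝ) ∈ H := by
  by_contra hneg
  have hc : Continuous fun ξ : EuclideanSpace ℝ (Fin d) => ξ 0 := by fun_prop
  rcases volume_eq_zero_or_volume_compl_eq_zero hH
    (B := {ξ | 0 < ξ 0}) (isOpen_lt continuous_const hc).measurableSet (fun h hh ξ hξ => by
      obtain ⟨ε, r, s, hs, e⟩ := hD.exists_eq h hh
      rcases Int.units_eq_one_or ε with rfl | rfl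
      · have h1 : 0 < (h : 𝕄) 0 0 := by
          rw [e, val_diagGL, Matrix.smul_apply, Matrix.diagonal_mul, hD.apply_self_of_mem_shear hs]
          simp [Real.exp_pos]
        simpa [hD.dualAct_apply_zero hh, h1] using hξ
      · refine absurd ?_ hneg
        have h1 : h = -1 * (diagGL y r * s) := Units.ext (by rw [e]; simp)
        have h2 : (-1 : GL (Fin d) ℝ) = h * (diagGL y r * s)⁻¹ := by rw [h1]; group
        rw [h2]
        exact H.mul_mem hh (H.inv_mem (H.mul_mem (hD.diag_mem r) (hD.le hs)))) with h | h
  · exact (isOpen_lt continuous_const hc).measure_ne_zero volume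
      ⟨EuclideanSpace.single 0 1, by simp⟩ h
  · refine (isOpen_lt hc continuous_const : IsOpen {ξ : EuclideanSpace ℝ (Fin d) | ξ 0 < 0}).measure_ne_zero
      volume ⟨EuclideanSpace.single 0 (-1), by simp⟩ (measure_mono_null (fun ξ hξ => ?_) h)
    simp only [Set.mem_compl_iff, Set.mem_ofPred_eq, not_lt] at hξ ⊢
    exact hξ.le

/-- The first rows of the elements of `S`, cut off after `k` entries, are arbitrary apart from the
leading entry. -/
def RowSurjective (S : Subgroup (GL (Fin d) ℝ)) (k : ℕ) : Prop :=
  ∀ η : Fin d → ℝ, η 0 = 1 → ∃ s ∈ S, ∀ j : Fin d, j.val < k → (s : 𝕄) 0 j = η j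

/-- Comparing first rows in `t * s = s * t`, for shears `t` with first row `η`, shows that `η`
annihilates column `j` of `N = s - 1`. As `η` is free beyond its leading 1, `η = e₀ + eᵢ` isolates
row `i`. -/
theorem shear_apply_eq_one_apply (hD : IsShearletDecomposition H S y) {k : ℕ}
    (hk : RowSurjective S k) {s : GL (Fin d) ℝ} (hs : s ∈ S)
    (h0 : ∀ j : Fin d, j.val < k → (s : 𝕄) 0 j = (1 : 𝕄) 0 j) (i j : Fin d) (hj : j.val < k) :
    (s : 𝕄) i j = (1 : 𝕄) i j := by
  set N : 𝕄 := (s : 𝕄) - 1 with hN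
  have hNU : N ∈ strictUpper d := isUpperUnipotent_iff.1 (hD.unipotent s hs)
  have hN0 : ∀ l : Fin d, l.val < k → N 0 l = 0 := fun l hl => by
    rw [hN, Matrix.sub_apply, h0 l hl, sub_self]
  have key : ∀ η : Fin d → ℝ, η 0 = 1 → ∑ l, η l * N l j = 0 := by
    intro η hη
    obtain ⟨t, ht, hη'⟩ := hk η hη
    have h1 : ((t : 𝕄) * N) 0 j = (N * (t : 𝕄)) 0 j := by
      have : (t : 𝕄) * s = s * t := congrArg Units.val (hD.comm t ht s hs)
      rw [hN, mul_sub, sub_mul, this, mul_one, one_mul]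
    have h2 : (N * (t : 𝕄)) 0 j = 0 := by
      rw [Matrix.mul_apply]
      refine Finset.sum_eq_zero fun l _ => ?_
      rcases lt_or_ge l.val k with h | h
      · rw [hN0 l h, zero_mul]
      · rw [hD.apply_eq_zero_of_mem_shear ht (Fin.lt_def.2 (hj.trans_le h)), mul_zero]
    rw [h2, Matrix.mul_apply] at h1
    rw [← h1]
    refine Finset.sum_congr rfl fun l _ => ?_
    rcases lt_or_ge l.val k with h | h
    · rw [hη' l h]
    · rw [hNU l j (Fin.le_def.2 (hj.le.trans h)), mul_zero, mul_zero]
  suffices N i j = 0 by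
    rw [hN, Matrix.sub_apply, sub_eq_zero] at this; exact this
  by_cases hi : i = 0
  · rw [hi, hN0 j hj]
  have h1 := key (Pi.single 0 1 + Pi.single i 1) (by simp [Ne.symm hi])
  simpa [add_mul, Finset.sum_add_distrib, Pi.single_apply, hN0 j hj] using h1

/-- The shear is the real power `exp (r log s)`; its first nontrivial row entry depends linearly on
`r`. -/
theorem exists_shear_smul (hD : IsShearletDecomposition H S y) {k : Fin d}
    {s : GL (Fin d) ℝ} (hs : s ∈ S) (h0 : ∀ j < k, (s : 𝕄) 0 j = (1 : 𝕄) 0 j) (r : ℝ) (hk : 0 < k) :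
    ∃ t ∈ S, (∀ j < k, (t : 𝕄) 0 j = (1 : 𝕄) 0 j) ∧ (t : 𝕄) 0 k = r * (s : 𝕄) 0 k := by
  set N : 𝕄 := (s : 𝕄) - 1 with hN
  have hNU : N ∈ strictUpper d := isUpperUnipotent_iff.1 (hD.unipotent s hs)
  have hN0 : ∀ l : Fin d, l.val < k.val → N 0 l = 0 := fun l hl => by
    rw [hN, Matrix.sub_apply, h0 l hl, sub_self]
  have hL0 : ∀ l : Fin d, l.val < k.val → (r • logPoly d N) 0 l = 0 := fun l hl => by
    rw [Matrix.smul_apply, logPoly_row hNU hN0 l hl.le, hN0 l hl, smul_zero]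
  have hLU : r • logPoly d N ∈ strictUpper d :=
    Submodule.smul_mem _ _ (logPoly_mem_strictUpper hNU)
  refine ⟨_, expGL_smul_logPoly_mem hD.isClosed hD.isConnected hD.comm hD.unipotent hs r,
    fun j hj => ?_, ?_⟩
  · refine (matrix_exp_row hLU hL0 j hj.le).trans ?_
    rw [hL0 j hj, add_zero]
  · refine (matrix_exp_row hLU hL0 k le_rfl).trans ?_
    rw [Matrix.smul_apply, logPoly_row hNU hN0 k le_rfl, hN, Matrix.sub_apply,
      Matrix.one_apply_ne hk.ne]
    simp

/-- Left multiplication by a shear with first row `e₀ + c eₖ` up to column `k` changes the first row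
of `t` there only in column `k`, by `c`. Here `c` is the missing amount `η k - t 0 k`. -/
theorem rowSurjective_succ_of_exists (hD : IsShearletDecomposition H S y) {k : Fin d} (hk0 : 0 < k)
    (hk : RowSurjective S k) {s : GL (Fin d) ℝ} (hs : s ∈ S)
    (h0 : ∀ j < k, (s : 𝕄) 0 j = (1 : 𝕄) 0 j) (hsk : (s : 𝕄) 0 k ≠ 0) :
    RowSurjective S (k + 1) := by
  intro η hη
  obtain ⟨t, ht, htη⟩ := hk η hη
  obtain ⟨u, hu, hu0, huk⟩ := hD.exists_shear_smul hs h0 ((η k - (t : 𝕄) 0 k) / (s : 𝕄) 0 k) hk0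
  rw [div_mul_cancel₀ _ hsk] at huk
  refine ⟨u * t, S.mul_mem hu ht, fun j hj => ?_⟩
  have hjk : j ≤ k := Fin.le_def.2 (Nat.lt_succ_iff.1 hj)
  have h1 : ((u * t : GL (Fin d) ℝ) : 𝕄) 0 j = ∑ l, ((1 : 𝕄) 0 l * (t : 𝕄) l j +
      if l = k then (η k - (t : 𝕄) 0 k) * (t : 𝕄) l j else 0) := by
    rw [Units.val_mul, Matrix.mul_apply]
    refine Finset.sum_congr rfl fun l _ => ?_
    rcases lt_trichotomy l k with h | rfl | h
    · rw [hu0 l h, if_neg h.ne, add_zero]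
    · rw [huk, if_pos rfl, Matrix.one_apply_ne hk0.ne, zero_mul, zero_add]
    · rw [hD.apply_eq_zero_of_mem_shear ht (hjk.trans_lt h), if_neg h.ne']; simp
  rw [h1, Finset.sum_add_distrib, ← Matrix.mul_apply, one_mul, Finset.sum_ite_eq' Finset.univ k]
  rcases hjk.lt_or_eq with h | rfl
  · rw [htη j h, hD.apply_eq_zero_of_mem_shear ht h]; simp
  · rw [hD.apply_self_of_mem_shear ht]; simp

end IsShearletDecomposition

end ShearletDilation

namespace ShearletDilation

/-! ### The dual orbit: transitivity and freeness. -/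

variable {d : ℕ} [NeZero d]

local notation "𝕄" => Matrix (Fin d) (Fin d) ℝ

namespace IsShearletDecomposition

variable {H S : Subgroup (GL (Fin d) ℝ)} {y : Fin d → ℝ}

theorem exists_mul_apply_zero (hD : IsShearletDecomposition H S y) (hy : y 0 ≠ 0)
    (hneg : (-1 : GL (Fin d) ℝ) ∈ H) {c : ℝ} (hc : c ≠ 0) : ∃ h ∈ H, c * (h : 𝕄) 0 0 = 1 := by
  have h1 : |c| * Real.exp (-Real.log |c| / y 0 * y 0) = 1 := by
    rw [div_mul_cancel₀ _ hy, Real.exp_neg, Real.exp_log (abs_pos.2 hc),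
      mul_inv_cancel₀ (abs_ne_zero.2 hc)]
  rcases hc.lt_or_gt with h | h
  · refine ⟨-1 * diagGL y (-Real.log |c| / y 0), H.mul_mem hneg (hD.diag_mem _), ?_⟩
    rw [Units.val_mul, val_diagGL]
    rw [abs_of_neg h] at h1 ⊢
    simpa using h1
  · refine ⟨diagGL y (-Real.log |c| / y 0), hD.diag_mem _, ?_⟩
    rw [val_diagGL]
    rw [abs_of_pos h] at h1 ⊢
    simpa using h1

/-- The leading entry is `± exp (r * y 0)`; being 1 it forces the plus sign and `r = 0`. -/
theorem mem_shear_of_apply_zero_eq_one (hD : IsShearletDecomposition H S y) (hy : y 0 ≠ 0)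
    {h : GL (Fin d) ℝ} (hh : h ∈ H) (h1 : (h : 𝕄) 0 0 = 1) : h ∈ S := by
  obtain ⟨ε, r, s, hs, e⟩ := hD.exists_eq h hh
  rw [e, val_diagGL, Matrix.smul_apply, Matrix.diagonal_mul, hD.apply_self_of_mem_shear hs] at h1
  rcases Int.units_eq_one_or ε with rfl | rfl
  · have hr : r = 0 := by simpa [hy] using h1
    subst hr
    have : h = s := Units.ext (by rw [e, val_diagGL]; simp)
    rwa [this]
  · have := Real.exp_pos (r * y 0)
    simp at h1
    linarith

/-- The first `k` coordinates of `ζ` agree with those of the first basis vector. -/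
def IsNormalized (k : ℕ) (ζ : EuclideanSpace ℝ (Fin d)) : Prop :=
  ∀ j : Fin d, j.val < k → ζ j = (1 : 𝕄) 0 j

theorem dualAct_apply_of_isNormalized (hD : IsShearletDecomposition H S y) {k : ℕ}
    {ζ : EuclideanSpace ℝ (Fin d)} (hζ : IsNormalized k ζ) {h : GL (Fin d) ℝ} (hh : h ∈ H)
    (j : Fin d) (hj : j.val < k) : dualAct h ζ j = (h : 𝕄) 0 j := by
  have : (h : 𝕄) 0 j = ∑ i, (1 : 𝕄) 0 i * (h : 𝕄) i j := by rw [← Matrix.mul_apply, one_mul]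
  rw [dualAct_apply, this]
  refine Finset.sum_congr rfl fun i _ => ?_
  rcases lt_or_ge i.val k with hi | hi
  · rw [hζ i hi]
  · rw [hD.apply_eq_zero hh (Fin.lt_def.2 (hj.trans_le hi)), mul_zero, mul_zero]

/-- Scale the leading coordinate to 1; the result agrees, before column `k`, with the first row of a
shear, whose inverse clears it. -/
theorem exists_isNormalized (hD : IsShearletDecomposition H S y) (hy : y 0 ≠ 0)
    (hneg : (-1 : GL (Fin d) ℝ) ∈ H) {k : ℕ} (hk : RowSurjective S k)
    {ξ : EuclideanSpace ℝ (Fin d)} (hξ : ξ 0 ≠ 0) : ∃ h ∈ H, IsNormalized k (dualAct h ξ) := by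
  obtain ⟨g, hg, hg1⟩ := hD.exists_mul_apply_zero hy hneg hξ
  obtain ⟨s, hs, hsη⟩ := hk (dualAct g ξ) (by rw [hD.dualAct_apply_zero hg, hg1])
  refine ⟨g * s⁻¹, H.mul_mem hg (H.inv_mem (hD.le hs)), fun j hj => ?_⟩
  have h1 : (1 : 𝕄) 0 j = ((s * s⁻¹ : GL (Fin d) ℝ) : 𝕄) 0 j := by simp
  rw [dualAct_mul, dualAct_apply, h1, Units.val_mul, Matrix.mul_apply]
  refine Finset.sum_congr rfl fun i _ => ?_
  rcases lt_or_ge i.val k with hi | hi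
  · rw [hsη i hi]
  · rw [hD.apply_eq_zero_of_mem_shear (S.inv_mem hs) (Fin.lt_def.2 (hj.trans_le hi)), mul_zero, mul_zero]

/-- If shears cannot reach column `k`, the `k`-th coordinate of a normal form is an invariant of the
orbit: an element joining two normal forms is a shear with trivial row before `k`, hence also at
`k`. -/
theorem dualAct_apply_eq_of_isNormalized (hD : IsShearletDecomposition H S y) (hy : y 0 ≠ 0)
    {k : Fin d} (hk0 : 0 < k)
    (hS : ∀ s ∈ S, (∀ j < k, (s : 𝕄) 0 j = (1 : 𝕄) 0 j) → (s : 𝕄) 0 k = 0)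
    {ζ : EuclideanSpace ℝ (Fin d)} (hζ : IsNormalized k ζ) {h : GL (Fin d) ℝ} (hh : h ∈ H)
    (hζ' : IsNormalized k (dualAct h ζ)) : dualAct h ζ k = ζ k := by
  have hrow : ∀ j < k, (h : 𝕄) 0 j = (1 : 𝕄) 0 j := fun j hj => by
    rw [← hD.dualAct_apply_of_isNormalized hζ hh j hj, hζ' j hj]
  have hs : h ∈ S := hD.mem_shear_of_apply_zero_eq_one hy hh (by rw [hrow 0 hk0, Matrix.one_apply_eq])
  rw [dualAct_apply, Finset.sum_eq_single k, hD.apply_self_of_mem_shear hs, mul_one]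
  · intro i _ hi
    rcases hi.lt_or_gt with h | h
    · rw [hζ i h]
      by_cases h0 : i = 0
      · rw [h0, hS _ hs hrow, mul_zero]
      · rw [Matrix.one_apply_ne (Ne.symm h0), zero_mul]
    · rw [hD.apply_eq_zero_of_mem_shear hs h, mul_zero]
  · simp

/-- Countably many translates of `B` cover the conull set `ξ 0 ≠ 0`. -/
theorem volume_ne_zero_of_translates {k : Fin d} {B : Set (EuclideanSpace ℝ (Fin d))}
    (hB : ∀ ξ : EuclideanSpace ℝ (Fin d), ξ 0 ≠ 0 → ∃ q : ℚ,
      ξ + EuclideanSpace.single k (q : ℝ) ∈ B) : volume B ≠ 0 := by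
  intro h0
  have h1 : (Set.univ : Set (EuclideanSpace ℝ (Fin d))) ⊆ {ξ | ξ 0 = 0} ∪
      ⋃ q : ℚ, (fun ξ => ξ + EuclideanSpace.single k (q : ℝ)) ⁻¹' B := fun ξ _ => by
    by_cases hξ : ξ 0 = 0
    · exact Or.inl hξ
    · exact Or.inr (Set.mem_iUnion.2 (hB ξ hξ))
  have h2 : volume (Set.univ : Set (EuclideanSpace ℝ (Fin d))) = 0 := by
    refine measure_mono_null h1 (measure_union_null (volume_coord_eq_zero 0) ?_)
    exact measure_iUnion_null fun q => by rw [measure_preimage_add_right, h0]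
  exact isOpen_univ.measure_ne_zero volume ⟨0, trivial⟩ h2

/-- The set of those `ξ` whose normal form has `k`-th coordinate of absolute value at most one. -/
def normalizedTube (H : Subgroup (GL (Fin d) ℝ)) (k : Fin d) : Set (EuclideanSpace ℝ (Fin d)) :=
  (fun p : GL (Fin d) ℝ × EuclideanSpace ℝ (Fin d) => dualAct p.1 p.2) ''
    {p | p.1 ∈ H ∧ IsNormalized k p.2 ∧ |p.2 k| ≤ 1}

theorem measurableSet_normalizedTube (hH : IsClosed (H : Set (GL (Fin d) ℝ))) (k : Fin d) :
    MeasurableSet (normalizedTube H k) := by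
  refine measurableSet_of_isSigmaCompact (IsSigmaCompact.image continuous_dualAct_uncurry ?_)
  refine isSigmaCompact_univ.of_isClosed_subset ?_ (Set.subset_univ _)
  have h1 : IsClosed {p : GL (Fin d) ℝ × EuclideanSpace ℝ (Fin d) | IsNormalized k p.2} := by
    have : {p : GL (Fin d) ℝ × EuclideanSpace ℝ (Fin d) | IsNormalized k p.2} =
        ⋂ j, {p | j.val < k.val → p.2 j = (1 : 𝕄) 0 j} := by
      ext p; simp only [Set.mem_iInter]; exact Iff.rfl
    rw [this]
    refine isClosed_iInter fun j => ?_
    by_cases hj : j.val < k.val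
    · simp only [hj, forall_const]
      exact isClosed_eq (by fun_prop) continuous_const
    · simp [hj]
  have h2 : IsClosed {p : GL (Fin d) ℝ × EuclideanSpace ℝ (Fin d) | |p.2 k| ≤ 1} :=
    isClosed_le (by fun_prop) continuous_const
  exact (hH.preimage continuous_fst).inter (h1.inter h2)

/-- Otherwise `normalizedTube H k` is invariant. Moving `ξ` along `eₖ` changes the invariant
coordinate affinely with nonzero slope `h k k`, so suitable rational translates of `ξ` lie inside
and outside the tube, and neither it nor its complement is null. -/
theorem exists_row_ne_zero (hD : IsShearletDecomposition H S y) (hcl : IsClosed (H : Set (GL (Fin d) ℝ)))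
    (hirr : IsIrreducibleRep H) {k : Fin d} (hk0 : 0 < k) (hk : RowSurjective S k) :
    ∃ s ∈ S, (∀ j < k, (s : 𝕄) 0 j = (1 : 𝕄) 0 j) ∧ (s : 𝕄) 0 k ≠ 0 := by
  by_contra! hS
  have hy := hD.exponent_ne_zero hirr
  have hneg := hD.neg_one_mem hirr
  have hmem : ∀ ξ, ∀ h ∈ H, IsNormalized k (dualAct h ξ) →
      (ξ ∈ normalizedTube H k ↔ |dualAct h ξ k| ≤ 1) := by
    intro ξ h hh hN
    constructor
    · rintro ⟨⟨g, ζ⟩, ⟨hg, hζ, hζk⟩, rfl⟩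
      simp only at hg hζ hζk hN ⊢
      rw [← dualAct_mul] at hN ⊢
      rwa [hD.dualAct_apply_eq_of_isNormalized hy hk0 hS hζ (H.mul_mem hg hh) hN]
    · intro hle
      refine ⟨⟨h⁻¹, dualAct h ξ⟩, ⟨H.inv_mem hh, hN, hle⟩, ?_⟩
      simp only
      rw [← dualAct_mul, mul_inv_cancel, dualAct_one]
  have htr : ∀ ξ, ∀ h ∈ H, IsNormalized k (dualAct h ξ) → ∀ q : ℝ,
      (ξ + EuclideanSpace.single k q ∈ normalizedTube H k ↔
        |dualAct h ξ k + q * (h : 𝕄) k k| ≤ 1) := by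
    intro ξ h hh hN q
    have h1 : ∀ j, dualAct h (ξ + EuclideanSpace.single k q) j =
        dualAct h ξ j + q * (h : 𝕄) k j := fun j => by
      rw [map_add, PiLp.add_apply, dualAct_apply h (EuclideanSpace.single k q)]
      congr 1
      rw [Finset.sum_eq_single k] <;> simp +contextual
    rw [hmem _ h hh, h1]
    intro j hj
    rw [h1, hD.apply_eq_zero hh (Fin.lt_def.2 hj), mul_zero, add_zero, hN j hj]
  rcases volume_eq_zero_or_volume_compl_eq_zero hirr (measurableSet_normalizedTube hcl k) (by
    rintro h hh _ ⟨⟨g, ζ⟩, ⟨hg, hζ⟩, rfl⟩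
    exact ⟨⟨g * h, ζ⟩, ⟨H.mul_mem hg hh, hζ⟩, dualAct_mul g h ζ⟩) with h0 | h0
  · refine volume_ne_zero_of_translates (k := k) (fun ξ hξ => ?_) h0
    obtain ⟨h, hh, hN⟩ := hD.exists_isNormalized hy hneg hk hξ
    have hu : 0 < |(h : 𝕄) k k| := abs_pos.2 (hD.apply_self_ne_zero hh k)
    -- This interval of length `1 / |h k k|` starts at the zero of the affine function, so its
    -- values there are less than 1 in absolute value.
    obtain ⟨q, hq1, hq2⟩ := exists_rat_btwn
      (lt_add_of_pos_right (-(dualAct h ξ k / (h : 𝕄) k k)) (inv_pos.2 hu))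
    refine ⟨q, (htr ξ h hh hN q).2 ?_⟩
    have h2 : dualAct h ξ k + q * (h : 𝕄) k k =
        (q + dualAct h ξ k / (h : 𝕄) k k) * (h : 𝕄) k k := by
      rw [add_mul, div_mul_cancel₀ _ (hD.apply_self_ne_zero hh k), add_comm]
    rw [h2, abs_mul, abs_of_pos (by linarith), ← inv_mul_cancel₀ hu.ne']
    exact mul_le_mul_of_nonneg_right (by linarith) hu.le
  · refine volume_ne_zero_of_translates (k := k) (fun ξ hξ => ?_) h0
    obtain ⟨h, hh, hN⟩ := hD.exists_isNormalized hy hneg hk hξ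
    have hu : 0 < |(h : 𝕄) k k| := abs_pos.2 (hD.apply_self_ne_zero hh k)
    obtain ⟨n, hn⟩ := exists_nat_gt ((1 + |dualAct h ξ k|) / |(h : 𝕄) k k|)
    refine ⟨n, fun hmem => ?_⟩
    have h2 := (htr ξ h hh hN _).1 hmem
    rw [div_lt_iff₀ hu] at hn
    have h3 := abs_sub_abs_le_abs_sub ((n : ℝ) * (h : 𝕄) k k) (-dualAct h ξ k)
    rw [sub_neg_eq_add, abs_neg, abs_mul, Nat.abs_cast, add_comm (_ * _)] at h3
    push_cast at h2
    linarith

theorem rowSurjective (hD : IsShearletDecomposition H S y) (hcl : IsClosed (H : Set (GL (Fin d) ℝ)))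
    (hirr : IsIrreducibleRep H) : RowSurjective S d := by
  suffices ∀ k, 1 ≤ k → k ≤ d → RowSurjective S k from this d (NeZero.one_le) le_rfl
  intro k hk
  induction k, hk using Nat.le_induction with
  | base =>
    intro _ η hη
    refine ⟨1, S.one_mem, fun j hj => ?_⟩
    have : j = 0 := Fin.ext (by simpa using hj)
    rw [this, hη]; simp
  | succ k hk ih =>
    intro hkd
    have hk0 : (0 : Fin d) < ⟨k, hkd⟩ := Fin.lt_def.2 hk
    have hS := ih (by omega)
    obtain ⟨s, hs, h0, hne⟩ := hD.exists_row_ne_zero hcl hirr (k := ⟨k, hkd⟩) hk0 hS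
    exact hD.rowSurjective_succ_of_exists hk0 hS hs h0 hne

/-- The first row of an invertible matrix. -/
noncomputable def firstRow (h : GL (Fin d) ℝ) : EuclideanSpace ℝ (Fin d) :=
  dualAct h (EuclideanSpace.single 0 1)

theorem firstRow_apply (h : GL (Fin d) ℝ) (j : Fin d) : firstRow h j = (h : 𝕄) 0 j := by
  rw [firstRow, dualAct_apply, Finset.sum_eq_single 0] <;> simp +contextual

theorem firstRow_mul (g h : GL (Fin d) ℝ) : firstRow (g * h) = dualAct h (firstRow g) :=
  dualAct_mul _ _ _

theorem continuous_firstRow : Continuous (firstRow (d := d)) :=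
  continuous_dualAct_uncurry.comp (f := fun h : GL (Fin d) ℝ =>
    (h, (EuclideanSpace.single 0 1 : EuclideanSpace ℝ (Fin d))))
    (continuous_id.prodMk continuous_const)

theorem exists_firstRow_eq (hD : IsShearletDecomposition H S y) (hcl : IsClosed (H : Set (GL (Fin d) ℝ)))
    (hirr : IsIrreducibleRep H) {ξ : EuclideanSpace ℝ (Fin d)} (hξ : ξ 0 ≠ 0) :
    ∃ h ∈ H, firstRow h = ξ := by
  obtain ⟨h, hh, hN⟩ := hD.exists_isNormalized (hD.exponent_ne_zero hirr) (hD.neg_one_mem hirr)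
    (hD.rowSurjective hcl hirr) hξ
  refine ⟨h⁻¹, H.inv_mem hh, ?_⟩
  have : dualAct h ξ = EuclideanSpace.single 0 1 := by
    ext j
    rw [hN j j.2, Matrix.one_apply]
    simp [eq_comm]
  rw [firstRow, ← this, ← dualAct_mul, mul_inv_cancel, dualAct_one]

/-- The stabiliser of the first basis vector is trivial: it consists of shears with trivial first
row. -/
theorem firstRow_injOn (hD : IsShearletDecomposition H S y) (hcl : IsClosed (H : Set (GL (Fin d) ℝ)))
    (hirr : IsIrreducibleRep H) : Set.InjOn firstRow (H : Set (GL (Fin d) ℝ)) := by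
  intro g hg h hh hgh
  have h1 : firstRow (g * h⁻¹) = EuclideanSpace.single 0 1 := by
    rw [firstRow_mul, hgh, ← firstRow_mul, mul_inv_cancel, firstRow, dualAct_one]
  have hH : g * h⁻¹ ∈ H := H.mul_mem hg (H.inv_mem hh)
  have h2 : ∀ j, ((g * h⁻¹ : GL (Fin d) ℝ) : 𝕄) 0 j = (1 : 𝕄) 0 j := fun j => by
    rw [← firstRow_apply, h1, Matrix.one_apply]
    simp [eq_comm]
  have h3 : g * h⁻¹ ∈ S := hD.mem_shear_of_apply_zero_eq_one (hD.exponent_ne_zero hirr) hH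
    ((h2 0).trans (Matrix.one_apply_eq 0))
  rw [← mul_inv_eq_one]
  refine Units.ext (Matrix.ext fun i j => ?_)
  exact hD.shear_apply_eq_one_apply (hD.rowSurjective hcl hirr) h3 (fun j _ => h2 j) i j j.2

theorem firstRow_apply_zero_ne_zero (hD : IsShearletDecomposition H S y) {h : GL (Fin d) ℝ}
    (hh : h ∈ H) : firstRow h 0 ≠ 0 := by
  rw [firstRow_apply]; exact hD.apply_self_ne_zero hh 0

end IsShearletDecomposition

end ShearletDilation

namespace ShearletDilation

/-! ### The invariant measure on the dual orbit. -/

section ShearMeasurePreserving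

/-- The fibrewise affine part of a unipotent shear whose matrix depends on the first coordinate. -/
theorem map_affine_shear {n : ℕ} {A : Matrix (Fin (n + 1)) (Fin (n + 1)) ℝ} (hA : IsUpperUnipotent A)
    (a : ℝ) :
    Measure.map (fun (η : Fin n → ℝ) (j : Fin n) => a * A 0 j.succ + ∑ i, η i * A i.succ j.succ)
      volume = volume := by
  set B : Matrix (Fin n) (Fin n) ℝ := Matrix.of fun j i => A i.succ j.succ with hB
  have hdet : B.det = 1 := by
    rw [← Matrix.det_transpose, Matrix.det_of_isUpperTriangular]
    · exact Finset.prod_eq_one fun i _ => hA.2 i.succ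
    · intro i j hij
      exact hA.1 _ _ (Fin.succ_lt_succ_iff.2 hij)
  have h1 : (fun (η : Fin n → ℝ) (j : Fin n) => a * A 0 j.succ + ∑ i, η i * A i.succ j.succ) =
      (fun η => (fun j : Fin n => a * A 0 j.succ) + η) ∘ Matrix.toLin' B := by
    ext η j
    simp [hB, Matrix.mulVec, dotProduct, mul_comm]
  rw [h1, ← Measure.map_map (measurable_const_add _)
    (LinearMap.continuous_of_finiteDimensional _).measurable,
    Real.map_matrix_volume_pi_eq_smul_volume_pi (by rw [hdet]; exact one_ne_zero), hdet]
  simp [map_add_left_eq_self]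

/-- The map is nonlinear, but it fixes `ξ 0` and acts on each fibre by an affine map of determinant
one, so it is a skew product. -/
theorem measurePreserving_shear {d : ℕ} [NeZero d] {M : ℝ → Matrix (Fin d) (Fin d) ℝ}
    (hM : ∀ i j, Measurable fun x => M x i j) (hU : ∀ x, IsUpperUnipotent (M x)) :
    MeasurePreserving (fun ξ : EuclideanSpace ℝ (Fin d) =>
      (WithLp.toLp 2 fun j => ∑ i, ξ i * M (ξ 0) i j : EuclideanSpace ℝ (Fin d))) := by
  obtain ⟨n, rfl⟩ : ∃ n, d = n + 1 := Nat.exists_eq_succ_of_ne_zero (NeZero.ne d)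
  have h1 := EuclideanSpace.volume_preserving_symm_measurableEquiv_toLp (Fin (n + 1))
  have h2 := volume_preserving_piFinSuccAbove (fun _ : Fin (n + 1) => ℝ) 0
  have h3 : MeasurePreserving (fun p : ℝ × (Fin n → ℝ) => ((p.1,
      fun j : Fin n => p.1 * M p.1 0 j.succ + ∑ i, p.2 i * M p.1 i.succ j.succ) : ℝ × (Fin n → ℝ)))
      volume volume := by
    refine (MeasurePreserving.id volume).skew_product (g := fun (a : ℝ) (η : Fin n → ℝ) (j : Fin n) =>
      a * M a 0 j.succ + ∑ i, η i * M a i.succ j.succ) ?_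
      (ae_of_all _ fun a => map_affine_shear (hU a) a)
    refine measurable_pi_lambda _ fun j => ?_
    refine Measurable.add (measurable_fst.mul ((hM _ _).comp measurable_fst)) ?_
    exact Finset.measurable_fun_sum _ fun i _ =>
      ((measurable_pi_apply i).comp measurable_snd).mul ((hM _ _).comp measurable_fst)
  have h4 := (h1.symm).comp ((h2.symm).comp (h3.comp (h2.comp h1)))
  convert h4 using 1
  ext ξ j
  refine Fin.cases ?_ (fun j => ?_) j
  · simp [MeasurableEquiv.piFinSuccAbove, Fin.sum_univ_succ]
    rw [(hU _).2, mul_one, Finset.sum_eq_zero, add_zero]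
    intro i _
    rw [(hU _).1 _ _ (Fin.succ_pos i), mul_zero]
  · simp [MeasurableEquiv.piFinSuccAbove, Fin.sum_univ_succ]
    rfl

end ShearMeasurePreserving

section WeightedMeasure

variable {d : ℕ} [NeZero d]

/-- The measure `|ξ₀|⁻ᵈ dξ`. -/
noncomputable def orbitMeasure (d : ℕ) [NeZero d] : Measure (EuclideanSpace ℝ (Fin d)) :=
  volume.withDensity fun ξ => (‖ξ 0‖ₑ ^ d)⁻¹

theorem measurable_orbit_density :
    Measurable fun ξ : EuclideanSpace ℝ (Fin d) => (‖ξ 0‖ₑ ^ d)⁻¹ := by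
  have : Measurable fun ξ : EuclideanSpace ℝ (Fin d) => ξ 0 :=
    Continuous.measurable (by fun_prop)
  fun_prop

theorem map_withDensity_eq_self {α : Type*} [MeasurableSpace α] {μ : Measure α} {T : α → α}
    (hT : Measurable T) {w : α → ℝ≥0∞} (hw : Measurable w) {c c' : ℝ≥0∞}
    (hmap : Measure.map T μ = c • μ) (hwT : ∀ x, w x = c' * w (T x)) (hc : c' * c = 1) :
    Measure.map T (μ.withDensity w) = μ.withDensity w := by
  ext s hs
  rw [Measure.map_apply hT hs, withDensity_apply _ (hT hs), withDensity_apply _ hs]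
  have h1 : ∫⁻ x in T ⁻¹' s, w x ∂μ = ∫⁻ x in T ⁻¹' s, c' * w (T x) ∂μ := lintegral_congr hwT
  rw [h1, ← setLIntegral_map (f := fun x => c' * w x) hs (hw.const_mul c') hT, hmap,
    Measure.restrict_smul, lintegral_smul_measure, lintegral_const_mul _ hw, smul_eq_mul, ← mul_assoc,
    mul_comm c, hc, one_mul]

/-- The source of the exponent `d`: scaling all `d` coordinates by `c` produces the Jacobian
`|c|⁻ᵈ`, which the weight in `ξ 0` compensates. -/
theorem map_smul_orbitMeasure {c : ℝ} (hc : c ≠ 0) :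
    Measure.map (fun ξ => c • ξ) (orbitMeasure d) = orbitMeasure d := by
  have h0 : ‖c‖ₑ ^ d ≠ 0 := pow_ne_zero _ (by simpa using hc)
  have h1 : ‖c‖ₑ ^ d ≠ ∞ := ENNReal.pow_ne_top (by simp)
  refine map_withDensity_eq_self (measurable_const_smul c) measurable_orbit_density
    (Measure.map_addHaar_smul volume hc) (c' := ‖c‖ₑ ^ d) (fun ξ => ?_) ?_
  · rw [PiLp.smul_apply, smul_eq_mul, enorm_mul, mul_pow, ENNReal.mul_inv (Or.inl h0) (Or.inl h1),
      ← mul_assoc, ENNReal.mul_inv_cancel h0 h1, one_mul]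
  · rw [finrank_euclideanSpace_fin, abs_inv, ENNReal.ofReal_inv_of_pos (by positivity), abs_pow,
      ENNReal.ofReal_pow (abs_nonneg c), ← Real.norm_eq_abs, ofReal_norm]
    exact ENNReal.mul_inv_cancel h0 h1

theorem map_shear_orbitMeasure {M : ℝ → Matrix (Fin d) (Fin d) ℝ}
    (hM : ∀ i j, Measurable fun x => M x i j) (hU : ∀ x, IsUpperUnipotent (M x)) :
    Measure.map (fun ξ : EuclideanSpace ℝ (Fin d) =>
      (WithLp.toLp 2 fun j => ∑ i, ξ i * M (ξ 0) i j : EuclideanSpace ℝ (Fin d))) (orbitMeasure d) =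
      orbitMeasure d := by
  have hp := measurePreserving_shear hM hU
  refine map_withDensity_eq_self hp.measurable measurable_orbit_density (c := 1) (c' := 1)
    (by rw [hp.map_eq, one_smul]) (fun ξ => ?_) (one_mul _)
  have : ∑ i, ξ i * M (ξ 0) i 0 = ξ 0 := by
    rw [Finset.sum_eq_single 0 (fun i _ hi => ?_) (by simp), (hU _).2, mul_one]
    rw [(hU _).1 _ _ (Fin.pos_iff_ne_zero.2 hi), mul_zero]
  simp [this]

theorem orbitMeasure_compl_ae : ∀ᵐ ξ ∂(orbitMeasure d), ξ 0 ≠ 0 := by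
  refine (withDensity_absolutelyContinuous _ _).ae_le ?_
  change ∀ᵐ ξ : EuclideanSpace ℝ (Fin d), ξ 0 ≠ 0
  rw [ae_iff]
  simpa using volume_coord_eq_zero (0 : Fin d)

theorem orbitMeasure_ne_zero : orbitMeasure d ≠ 0 := by
  intro h
  have h1 := (withDensity_eq_zero_iff measurable_orbit_density.aemeasurable).1 h
  have h2 : ∀ᵐ ξ : EuclideanSpace ℝ (Fin d), False := by
    filter_upwards [h1] with ξ hξ
    simp [ENNReal.pow_eq_top_iff] at hξ
  simp only [Filter.eventually_false_iff_eq_bot, ae_eq_bot] at h2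
  exact NeZero.ne (volume : Measure (EuclideanSpace ℝ (Fin d))) h2

theorem orbitMeasure_lt_top_of_isCompact {K : Set (EuclideanSpace ℝ (Fin d))} (hK : IsCompact K)
    (h0 : ∀ ξ ∈ K, ξ 0 ≠ 0) : orbitMeasure d K < ∞ := by
  have h1 : IntegrableOn (fun ξ : EuclideanSpace ℝ (Fin d) => (ξ 0 ^ d)⁻¹) K := by
    refine ContinuousOn.integrableOn_compact hK (ContinuousOn.inv₀ ?_ fun ξ hξ => pow_ne_zero _ (h0 ξ hξ))
    fun_prop
  rw [orbitMeasure, withDensity_apply _ hK.measurableSet]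
  refine lt_of_eq_of_lt ?_ h1.2
  refine setLIntegral_congr_fun hK.measurableSet fun ξ hξ => ?_
  simp only
  rw [enorm_inv (pow_ne_zero _ (h0 ξ hξ)), enorm_pow]

end WeightedMeasure

end ShearletDilation

namespace ShearletDilation

/-! ### Haar measure on the dual orbit. -/

variable {d : ℕ} [NeZero d]

local notation "𝕄" => Matrix (Fin d) (Fin d) ℝ

namespace IsShearletDecomposition

variable {H S : Subgroup (GL (Fin d) ℝ)} {y : Fin d → ℝ}

/-- The conjugate of `t` by the diagonal part belonging to the leading coordinate `x`. -/
noncomputable def conjDiag (y : Fin d → ℝ) (t : GL (Fin d) ℝ) (x : ℝ) : GL (Fin d) ℝ :=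
  (diagGL y (Real.log |x| / y 0))⁻¹ * t * diagGL y (Real.log |x| / y 0)

theorem conjDiag_apply (y : Fin d → ℝ) (t : GL (Fin d) ℝ) (x : ℝ) (i j : Fin d) :
    (conjDiag y t x : 𝕄) i j = Real.exp (-(Real.log |x| / y 0) * y i) * (t : 𝕄) i j *
      Real.exp (Real.log |x| / y 0 * y j) := by
  have h1 : (((diagGL y (Real.log |x| / y 0))⁻¹ : GL (Fin d) ℝ) : 𝕄) =
    Matrix.diagonal fun i => Real.exp (-(Real.log |x| / y 0) * y i) := rfl
  rw [conjDiag, Units.val_mul, Units.val_mul, h1, val_diagGL, Matrix.mul_diagonal,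
    Matrix.diagonal_mul]

theorem measurable_conjDiag (y : Fin d → ℝ) (t : GL (Fin d) ℝ) (i j : Fin d) :
    Measurable fun x => (conjDiag y t x : 𝕄) i j := by
  simp_rw [conjDiag_apply]
  have : Measurable fun x : ℝ => |x| := continuous_abs.measurable
  fun_prop

theorem conjDiag_mem (hD : IsShearletDecomposition H S y) (hy : y 0 ≠ 0) {t : GL (Fin d) ℝ}
    (ht : t ∈ S) (x : ℝ) : conjDiag y t x ∈ S := by
  refine hD.mem_shear_of_apply_zero_eq_one hy
    (H.mul_mem (H.mul_mem (H.inv_mem (hD.diag_mem _)) (hD.le ht)) (hD.diag_mem _)) ?_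
  rw [conjDiag_apply, hD.apply_self_of_mem_shear ht, mul_one, ← Real.exp_add]
  simp

/-- In `h = ± a s` the sign is central and `s` commutes with the conjugated shear, so only
conjugation by `a` remains; `a` is determined by `|h 0 0| = exp (r * y 0)`. -/
theorem mul_eq_mul_conjDiag (hD : IsShearletDecomposition H S y) (hy : y 0 ≠ 0)
    {t h : GL (Fin d) ℝ} (ht : t ∈ S) (hh : h ∈ H) :
    t * h = h * conjDiag y t (firstRow h 0) := by
  obtain ⟨ε, r, s, hs, e⟩ := hD.exists_eq h hh
  have hr : Real.log |firstRow h 0| / y 0 = r := by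
    rw [firstRow_apply, e, val_diagGL, Matrix.smul_apply, Matrix.diagonal_mul,
      hD.apply_self_of_mem_shear hs]
    rcases Int.units_eq_one_or ε with rfl | rfl <;> simp [hy]
  have h1 := hD.comm s hs _ (hD.conjDiag_mem hy ht (firstRow h 0))
  have h2 : t * (diagGL y r * s) = diagGL y r * s * conjDiag y t (firstRow h 0) := by
    rw [mul_assoc, h1, conjDiag, hr]
    group
  have h3 : (t : 𝕄) * ((diagGL y r : 𝕄) * (s : 𝕄)) =
      (diagGL y r : 𝕄) * (s : 𝕄) * (conjDiag y t (firstRow h 0) : 𝕄) := congrArg Units.val h2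
  refine Units.ext ?_
  rw [Units.val_mul, Units.val_mul, e, mul_smul_comm, smul_mul_assoc, h3]

theorem firstRow_shear_mul (hD : IsShearletDecomposition H S y) (hy : y 0 ≠ 0)
    {t h : GL (Fin d) ℝ} (ht : t ∈ S) (hh : h ∈ H) :
    firstRow (t * h) = WithLp.toLp 2 fun j =>
      ∑ i, firstRow h i * (conjDiag y t (firstRow h 0) : 𝕄) i j := by
  ext j
  rw [hD.mul_eq_mul_conjDiag hy ht hh, firstRow_mul, dualAct_apply]

theorem firstRow_mul_of_smul {g : GL (Fin d) ℝ} {c : ℝ} (hg : ∀ j, (g : 𝕄) 0 j = c * (1 : 𝕄) 0 j)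
    (h : GL (Fin d) ℝ) : firstRow (g * h) = c • firstRow h := by
  have : firstRow g = c • EuclideanSpace.single 0 1 := by
    ext j
    rw [firstRow_apply, hg, Matrix.one_apply]
    simp [eq_comm]
  rw [firstRow_mul, this, map_smul, firstRow]

/-- The left Haar measures of `H`, transported to the dual orbit. -/
theorem exists_orbitMeasure_eq_smul_map (hD : IsShearletDecomposition H S y)
    (hcl : IsClosed (H : Set (GL (Fin d) ℝ))) (hirr : IsIrreducibleRep H) (μ : Measure H)
    [μ.IsHaarMeasure] :
    ∃ c : ℝ≥0∞, c ≠ 0 ∧ c ≠ ∞ ∧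
      orbitMeasure d = c • Measure.map (fun h : H => firstRow (h : GL (Fin d) ℝ)) μ := by
  have hy := hD.exponent_ne_zero hirr
  have : PolishSpace H := hcl.polishSpace
  have : LocallyCompactSpace H := hcl.isClosedEmbedding_subtypeVal.locallyCompactSpace
  set p : H → EuclideanSpace ℝ (Fin d) := fun h => firstRow (h : GL (Fin d) ℝ) with hp
  have hpc : Continuous p := continuous_firstRow.comp continuous_subtype_val
  -- A continuous injection from a Polish space is a Borel embedding, so the orbit measure can be
  -- pulled back to `H`.
  have hpe : MeasurableEmbedding p := hpc.measurableEmbedding fun g h hgh =>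
    Subtype.ext (hD.firstRow_injOn hcl hirr g.2 h.2 hgh)
  set ν : Measure H := Measure.comap p (orbitMeasure d) with hν
  have hmap : Measure.map p ν = orbitMeasure d := by
    rw [hν, hpe.map_comap]
    refine Measure.restrict_eq_self_of_ae_mem ?_
    filter_upwards [orbitMeasure_compl_ae] with ξ hξ
    obtain ⟨h, hh, e⟩ := hD.exists_firstRow_eq hcl hirr hξ
    exact ⟨⟨h, hh⟩, e⟩
  have hinv : ∀ (g : H) (T : EuclideanSpace ℝ (Fin d) → EuclideanSpace ℝ (Fin d)), Measurable T →
      (∀ h, p (g * h) = T (p h)) → Measure.map T (orbitMeasure d) = orbitMeasure d →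
      Measure.map (g * ·) ν = ν := by
    intro g T hT h1 h2
    have hg : Measurable fun h : H => g * h := (continuous_const_mul g).measurable
    rw [← hpe.comap_map (Measure.map (g * ·) ν), Measure.map_map hpc.measurable hg]
    have h3 : p ∘ (g * ·) = T ∘ p := funext h1
    rw [h3, ← Measure.map_map hT hpc.measurable, hmap, h2]
  have hscal : ∀ (g : H) (c : ℝ), c ≠ 0 → (∀ j, ((g : GL (Fin d) ℝ) : 𝕄) 0 j = c * (1 : 𝕄) 0 j) →
      Measure.map (g * ·) ν = ν := fun g c hc hg =>
    hinv g (fun ξ => c • ξ) (measurable_const_smul c) (fun h => firstRow_mul_of_smul hg _)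
      (map_smul_orbitMeasure hc)
  have hshear : ∀ t : H, (t : GL (Fin d) ℝ) ∈ S → Measure.map (t * ·) ν = ν := fun t ht =>
    hinv t _ (measurePreserving_shear (measurable_conjDiag y t)
      fun x => hD.unipotent _ (hD.conjDiag_mem hy ht x)).measurable
      (fun h => hD.firstRow_shear_mul hy ht h.2)
      (map_shear_orbitMeasure (measurable_conjDiag y t)
        fun x => hD.unipotent _ (hD.conjDiag_mem hy ht x))
  have hmul : ∀ g h : H, Measure.map (g * ·) ν = ν → Measure.map (h * ·) ν = ν →
      Measure.map (g * h * ·) ν = ν := by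
    intro g h hg hh
    have : (g * h * · : H → H) = (g * ·) ∘ (h * ·) := by ext x; simp [mul_assoc]
    rw [this, ← Measure.map_map (continuous_const_mul g).measurable
      (continuous_const_mul h).measurable, hh, hg]
  -- It suffices to treat `-1`, diagonal elements and shears; the first two have first row a
  -- multiple of `e₀` and act by scalars.
  have hleft : ν.IsMulLeftInvariant := by
    refine ⟨fun g => ?_⟩
    obtain ⟨ε, r, s, hs, e⟩ := hD.exists_eq g g.2
    have h1 : Measure.map ((⟨diagGL y r, hD.diag_mem r⟩ * ⟨s, hD.le hs⟩ : H) * ·) ν = ν :=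
      hmul _ _ (hscal _ (Real.exp (r * y 0)) (Real.exp_ne_zero _) fun j => by
        simp [val_diagGL, Matrix.diagonal_apply, Matrix.one_apply]) (hshear _ hs)
    rcases Int.units_eq_one_or ε with rfl | rfl
    · have : g = ⟨diagGL y r, hD.diag_mem r⟩ * ⟨s, hD.le hs⟩ :=
        Subtype.ext (Units.ext (by simp [e]))
      rw [this]; exact h1
    · have : g = ⟨-1, hD.neg_one_mem hirr⟩ * (⟨diagGL y r, hD.diag_mem r⟩ * ⟨s, hD.le hs⟩) :=
        Subtype.ext (Units.ext (by simp [e]))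
      rw [this]
      exact hmul _ _ (hscal _ (-1) (by norm_num) fun j => by simp) h1
  have hfin : IsFiniteMeasureOnCompacts ν := by
    refine ⟨fun K hK => ?_⟩
    rw [hν, hpe.comap_apply]
    refine orbitMeasure_lt_top_of_isCompact (hK.image hpc) ?_
    rintro _ ⟨h, -, rfl⟩
    exact hD.firstRow_apply_zero_ne_zero h.2
  have hsmul := Measure.isMulLeftInvariant_eq_smul ν μ
  have hmap' : orbitMeasure d = (ν.haarScalarFactor μ : ℝ≥0∞) • Measure.map p μ := by
    rw [← hmap]
    conv_lhs => rw [hsmul]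
    rw [Measure.map_smul]
    rfl
  refine ⟨(ν.haarScalarFactor μ : ℝ≥0∞), fun h0 => ?_, ENNReal.coe_ne_top, hmap'⟩
  rw [h0, zero_smul] at hmap'
  exact orbitMeasure_ne_zero hmap'

end IsShearletDecomposition

end ShearletDilation

namespace ShearletDilation

variable {d : ℕ}

/-! ### Matrix coefficients and the admissibility criterion. -/

section Coefficients

/-- After Parseval, `x` occurs only in a character, so the coefficient is an inverse Fourier
integral in `x`. -/
theorem inner_quasiRegular_eq (x : EuclideanSpace ℝ (Fin d)) (h : GL (Fin d) ℝ) (ψ : L2 d) :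
    inner ℂ (quasiRegular x h ψ) ψ =
      ((|(h : Matrix (Fin d) (Fin d) ℝ).det| ^ (1 / 2 : ℝ) : ℝ) : ℂ) *
        𝓕⁻ (fun ξ => (starRingEnd ℂ) ((𝓕 ψ : L2 d) (dualAct h ξ)) * (𝓕 ψ : L2 d) ξ) x := by
  rw [← Lp.inner_fourier_eq, L2.inner_def, Real.fourierInv_eq, ← integral_const_mul]
  refine integral_congr_ae ?_
  filter_upwards [fourier_quasiRegular x h ψ] with ξ hξ
  rw [hξ, RCLike.inner_apply, map_mul, map_mul, Complex.conj_ofReal, Circle.smul_def, smul_eq_mul,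
    ← Circle.coe_inv_eq_conj, ← AddChar.map_neg_eq_inv, neg_neg, real_inner_comm]
  ring

theorem integrable_conj_mul (h : GL (Fin d) ℝ) (Ψ : L2 d) :
    Integrable fun ξ => (starRingEnd ℂ) (Ψ (dualAct h ξ)) * Ψ ξ := by
  have h1 : MemLp (fun ξ => (1 : ℂ) * Ψ (dualAct h ξ)) 2 :=
    memLp_mul_comp (continuous_dualAct h).measurable ENNReal.ofReal_ne_top (map_dualAct h)
      measurable_const (M := 1) (by simp) (Lp.memLp Ψ)
  simp only [one_mul] at h1
  exact (h1.star).integrable_mul (Lp.memLp Ψ)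

/-- The density `|det h|⁻¹` cancels the square of `|det h|^(1/2)`; Plancherel applies even when both
sides are infinite. -/
theorem lintegral_enorm_inner_quasiRegular_sq (h : GL (Fin d) ℝ) (ψ : L2 d) :
    ∫⁻ x, ‖(inner ℂ (quasiRegular x h ψ) ψ : ℂ)‖ₑ ^ 2 *
        ENNReal.ofReal |(h : Matrix (Fin d) (Fin d) ℝ).det|⁻¹ =
      ∫⁻ ξ, ‖(𝓕 ψ : L2 d) (dualAct h ξ)‖ₑ ^ 2 * ‖(𝓕 ψ : L2 d) ξ‖ₑ ^ 2 := by
  have hD : 0 < |(h : Matrix (Fin d) (Fin d) ℝ).det| := abs_pos.2 (det_ne_zero_GL h)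
  have h1 : ∀ x : EuclideanSpace ℝ (Fin d), ‖(inner ℂ (quasiRegular x h ψ) ψ : ℂ)‖ₑ ^ 2 *
      ENNReal.ofReal |(h : Matrix (Fin d) (Fin d) ℝ).det|⁻¹ =
      ‖𝓕⁻ (fun ξ => (starRingEnd ℂ) ((𝓕 ψ : L2 d) (dualAct h ξ)) * (𝓕 ψ : L2 d) ξ) x‖ₑ ^ 2 := by
    intro x
    have h2 : ‖((|(h : Matrix (Fin d) (Fin d) ℝ).det| ^ (1 / 2 : ℝ) : ℝ) : ℂ)‖ₑ ^ 2 =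
        ENNReal.ofReal |(h : Matrix (Fin d) (Fin d) ℝ).det| := by
      rw [← ofReal_norm, Complex.norm_real, Real.norm_of_nonneg (by positivity),
        ← ENNReal.ofReal_pow (by positivity), ← Real.rpow_natCast, ← Real.rpow_mul hD.le]
      norm_num
    rw [inner_quasiRegular_eq, enorm_mul, mul_pow, h2, mul_comm, ← mul_assoc,
      ← ENNReal.ofReal_mul (by positivity), inv_mul_cancel₀ hD.ne', ENNReal.ofReal_one, one_mul]
  simp_rw [h1]
  rw [lintegral_enorm_fourierInv_sq (integrable_conj_mul h (𝓕 ψ))]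
  simp only [enorm_mul, mul_pow, RCLike.enorm_conj]

theorem measurable_dualAct_uncurry {α : Type*} [MeasurableSpace α] {H : Subgroup (GL (Fin d) ℝ)}
    {f : α → H} {g : α → EuclideanSpace ℝ (Fin d)} (hf : Measurable f) (hg : Measurable g) :
    Measurable fun a => dualAct (f a : GL (Fin d) ℝ) (g a) := by
  have h1 : Measurable fun p : GL (Fin d) ℝ × EuclideanSpace ℝ (Fin d) => dualAct p.1 p.2 :=
    continuous_dualAct_uncurry.measurable
  have h2 : Measurable fun a => ((f a : GL (Fin d) ℝ), g a) :=
    (measurable_subtype_coe.comp hf).prodMk hg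
  have h3 := Measurable.comp
    (g := fun p : GL (Fin d) ℝ × EuclideanSpace ℝ (Fin d) => dualAct p.1 p.2) h1 h2
  exact h3

theorem measurable_abs_det {H : Subgroup (GL (Fin d) ℝ)} :
    Measurable fun h : H => |((h : GL (Fin d) ℝ) : Matrix (Fin d) (Fin d) ℝ).det| := by
  have : Continuous fun h : H => |((h : GL (Fin d) ℝ) : Matrix (Fin d) (Fin d) ℝ).det| :=
    (Continuous.matrix_det (Units.continuous_val.comp continuous_subtype_val)).abs
  exact this.measurable

theorem measurable_fourierChar_inner {α : Type*} [MeasurableSpace α]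
    {f g : α → EuclideanSpace ℝ (Fin d)} (hf : Measurable f) (hg : Measurable g) :
    Measurable fun a => (Real.fourierChar (inner ℝ (f a) (g a)) : ℂ) := by
  have h1 : Continuous fun t : ℝ => (Real.fourierChar t : ℂ) :=
    continuous_subtype_val.comp Real.continuous_fourierChar
  exact h1.measurable.comp (hf.inner hg)

theorem measurable_inner_quasiRegular (H : Subgroup (GL (Fin d) ℝ)) (ψ : L2 d) :
    Measurable fun p : EuclideanSpace ℝ (Fin d) × H => (inner ℂ (quasiRegular p.1 p.2 ψ) ψ : ℂ) := by
  simp_rw [inner_quasiRegular_eq, Real.fourierInv_eq]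
  have hΨ : Measurable (𝓕 ψ : L2 d) := (Lp.stronglyMeasurable _).measurable
  refine Measurable.mul ?_ ?_
  · exact Complex.measurable_ofReal.comp
      ((measurable_abs_det.comp measurable_snd).pow_const (1 / 2 : ℝ))
  · refine (StronglyMeasurable.integral_prod_right' (f := fun q : (EuclideanSpace ℝ (Fin d) × H) ×
      EuclideanSpace ℝ (Fin d) => Real.fourierChar (inner ℝ q.2 q.1.1) •
        ((starRingEnd ℂ) ((𝓕 ψ : L2 d) (dualAct (q.1.2 : GL (Fin d) ℝ) q.2)) *
          (𝓕 ψ : L2 d) q.2)) (Measurable.stronglyMeasurable ?_)).measurable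
    simp_rw [Circle.smul_def, smul_eq_mul]
    refine Measurable.mul ?_ (Measurable.mul ?_ (hΨ.comp measurable_snd))
    · exact measurable_fourierChar_inner measurable_snd (measurable_fst.comp measurable_fst)
    · exact RCLike.continuous_conj.measurable.comp (hΨ.comp
        (measurable_dualAct_uncurry (measurable_snd.comp measurable_fst) measurable_snd))

/-- The square of the `L²(G)`-norm of the matrix coefficient. -/
theorem lintegral_enorm_coefficient_sq (H : Subgroup (GL (Fin d) ℝ)) (μ : Measure H) [SFinite μ]
    (ψ : L2 d) :
    ∫⁻ p : EuclideanSpace ℝ (Fin d) × H, ‖(inner ℂ (quasiRegular p.1 p.2 ψ) ψ : ℂ)‖ₑ ^ 2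
        ∂(affineHaar H μ) =
      ∫⁻ ξ, ‖(𝓕 ψ : L2 d) ξ‖ₑ ^ 2 *
        ∫⁻ h : H, ‖(𝓕 ψ : L2 d) (dualAct (h : GL (Fin d) ℝ) ξ)‖ₑ ^ 2 ∂μ := by
  have hΨ : Measurable (𝓕 ψ : L2 d) := (Lp.stronglyMeasurable _).measurable
  have h1 := (measurable_inner_quasiRegular H ψ).enorm.pow_const 2
  have h2 : Measurable fun p : EuclideanSpace ℝ (Fin d) × H =>
      ENNReal.ofReal |((p.2 : GL (Fin d) ℝ) : Matrix (Fin d) (Fin d) ℝ).det|⁻¹ :=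
    ((measurable_abs_det.comp measurable_snd).inv).ennreal_ofReal
  rw [affineHaar, lintegral_withDensity_eq_lintegral_mul _ h2 h1, lintegral_prod_symm _
    (h2.mul h1).aemeasurable]
  simp only [Pi.mul_apply]
  have h3 : ∀ h : H, ∫⁻ x, ENNReal.ofReal |((h : GL (Fin d) ℝ) : Matrix (Fin d) (Fin d) ℝ).det|⁻¹ *
      ‖(inner ℂ (quasiRegular x h ψ) ψ : ℂ)‖ₑ ^ 2 =
      ∫⁻ ξ, ‖(𝓕 ψ : L2 d) (dualAct (h : GL (Fin d) ℝ) ξ)‖ₑ ^ 2 * ‖(𝓕 ψ : L2 d) ξ‖ₑ ^ 2 := by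
    intro h
    rw [← lintegral_enorm_inner_quasiRegular_sq]
    simp_rw [mul_comm]
  simp_rw [h3]
  have h4 : Measurable fun p : H × EuclideanSpace ℝ (Fin d) =>
      ‖(𝓕 ψ : L2 d) (dualAct (p.1 : GL (Fin d) ℝ) p.2)‖ₑ ^ 2 :=
    (hΨ.comp (measurable_dualAct_uncurry measurable_fst measurable_snd)).enorm.pow_const 2
  rw [lintegral_lintegral_swap (h4.mul ((hΨ.comp measurable_snd).enorm.pow_const 2)).aemeasurable]
  refine lintegral_congr fun ξ => ?_
  have h5 : Measurable fun h : H => ‖(𝓕 ψ : L2 d) (dualAct (h : GL (Fin d) ℝ) ξ)‖ₑ ^ 2 :=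
    (hΨ.comp (measurable_dualAct_uncurry measurable_id measurable_const)).enorm.pow_const 2
  rw [lintegral_mul_const _ h5, mul_comm]

theorem isAdmissible_iff (H : Subgroup (GL (Fin d) ℝ)) (μ : Measure H) [SFinite μ] (ψ : L2 d) :
    IsAdmissible H μ ψ ↔
      ∫⁻ ξ, ‖(𝓕 ψ : L2 d) ξ‖ₑ ^ 2 *
        ∫⁻ h : H, ‖(𝓕 ψ : L2 d) (dualAct (h : GL (Fin d) ℝ) ξ)‖ₑ ^ 2 ∂μ < ∞ := by
  rw [← lintegral_enorm_coefficient_sq, IsAdmissible, MemLp,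
    eLpNorm_lt_top_iff_lintegral_rpow_enorm_lt_top (by norm_num) (by norm_num),
    and_iff_right (measurable_inner_quasiRegular H ψ).aestronglyMeasurable]
  simp

end Coefficients

variable [NeZero d]

open IsShearletDecomposition in
-- Writing `ξ` as the first row of `k`, the point `hᵀ ξ` is the first row of `k * h`, and left
-- invariance removes `k`.
theorem lintegral_dualAct_eq {H S : Subgroup (GL (Fin d) ℝ)} {y : Fin d → ℝ}
    (hD : IsShearletDecomposition H S y) (hcl : IsClosed (H : Set (GL (Fin d) ℝ)))
    (hirr : IsIrreducibleRep H) (μ : Measure H) [μ.IsMulLeftInvariant]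
    (F : EuclideanSpace ℝ (Fin d) → ℝ≥0∞) {ξ : EuclideanSpace ℝ (Fin d)} (hξ : ξ 0 ≠ 0) :
    ∫⁻ h : H, F (dualAct (h : GL (Fin d) ℝ) ξ) ∂μ = ∫⁻ h : H, F (firstRow (h : GL (Fin d) ℝ)) ∂μ := by
  obtain ⟨k, hk, rfl⟩ := hD.exists_firstRow_eq hcl hirr hξ
  rw [← lintegral_mul_left_eq_self (μ := μ) (fun h : H => F (firstRow (h : GL (Fin d) ℝ))) ⟨k, hk⟩]
  refine lintegral_congr fun h => ?_
  rw [Subgroup.coe_mul, firstRow_mul]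

open IsShearletDecomposition in
/-- Admissibility is equivalent to finiteness of the weighted integral over the dual orbit. -/
theorem isAdmissible_iff_lintegral_lt_top (H : Subgroup (GL (Fin d) ℝ))
    (hH : IsGeneralizedShearletGroup H) (μ : Measure H) [μ.IsHaarMeasure] (ψ : L2 d) :
    IsAdmissible H μ ψ ↔
      ∫⁻ ξ : EuclideanSpace ℝ (Fin d), ‖(𝓕 ψ : L2 d) ξ‖ₑ ^ 2 / ‖ξ 0‖ₑ ^ d < ∞ := by
  have hcl := hH.irreduciblyAdmissible.isClosed
  have hirr := hH.irreduciblyAdmissible.irreducible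
  obtain ⟨S, y, hD⟩ := hH.exists_decomposition
  have : LocallyCompactSpace H := hcl.isClosedEmbedding_subtypeVal.locallyCompactSpace
  obtain ⟨c, hc0, hc, hμ⟩ := hD.exists_orbitMeasure_eq_smul_map hcl hirr μ
  have hΨ : Measurable (𝓕 ψ : L2 d) := (Lp.stronglyMeasurable _).measurable
  have hF : Measurable fun ξ => ‖(𝓕 ψ : L2 d) ξ‖ₑ ^ 2 := hΨ.enorm.pow_const 2
  have hp : Measurable fun h : H => firstRow (h : GL (Fin d) ℝ) :=
    (continuous_firstRow.comp continuous_subtype_val).measurable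
  set A : ℝ≥0∞ := ∫⁻ h : H, ‖(𝓕 ψ : L2 d) (firstRow (h : GL (Fin d) ℝ))‖ₑ ^ 2 ∂μ with hA
  have hI : ∫⁻ ξ : EuclideanSpace ℝ (Fin d), ‖(𝓕 ψ : L2 d) ξ‖ₑ ^ 2 / ‖ξ 0‖ₑ ^ d = c * A := by
    rw [hA, ← lintegral_map hF hp, ← smul_eq_mul, ← lintegral_smul_measure, ← hμ, orbitMeasure,
      lintegral_withDensity_eq_lintegral_mul _ measurable_orbit_density hF]
    refine lintegral_congr fun ξ => ?_
    rw [Pi.mul_apply, mul_comm, div_eq_mul_inv]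
  have hcoef : ∫⁻ ξ, ‖(𝓕 ψ : L2 d) ξ‖ₑ ^ 2 *
      ∫⁻ h : H, ‖(𝓕 ψ : L2 d) (dualAct (h : GL (Fin d) ℝ) ξ)‖ₑ ^ 2 ∂μ = ‖ψ‖ₑ ^ 2 * A := by
    have h1 : ‖ψ‖ₑ ^ 2 = ∫⁻ ξ, ‖(𝓕 ψ : L2 d) ξ‖ₑ ^ 2 := by
      rw [lintegral_enorm_sq_eq_enorm_sq, ← ofReal_norm, ← ofReal_norm, Lp.norm_fourier_eq]
    rw [h1, ← lintegral_mul_const _ hF]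
    refine lintegral_congr_ae ?_
    have h2 : ∀ᵐ ξ : EuclideanSpace ℝ (Fin d), ξ 0 ≠ 0 := by
      rw [ae_iff]; simpa using volume_coord_eq_zero (0 : Fin d)
    filter_upwards [h2] with ξ hξ
    rw [lintegral_dualAct_eq hD hcl hirr μ (fun ξ => ‖(𝓕 ψ : L2 d) ξ‖ₑ ^ 2) hξ]
  have : PolishSpace H := hcl.polishSpace
  have : SigmaFinite μ := Measure.IsHaarMeasure.sigmaFinite μ
  rw [isAdmissible_iff, hcoef, hI]
  -- For `ψ ≠ 0` the factor `‖ψ‖ₑ ^ 2` is finite and nonzero and can be cancelled; for `ψ = 0` the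
  -- product carries no information on `A`, so the weighted integral is computed directly.
  by_cases hψ : ψ = 0
  · have h0 : c * A = 0 := by
      rw [← hI, lintegral_eq_zero_iff' (by
        simp_rw [div_eq_mul_inv]
        exact (hF.mul measurable_orbit_density).aemeasurable)]
      have h1 : (𝓕 ψ : L2 d) = 0 := by
        rw [hψ]; exact (Lp.fourierTransformₗᵢ (EuclideanSpace ℝ (Fin d)) ℂ).map_zero
      filter_upwards [(Lp.eq_zero_iff_ae_eq_zero).1 h1] with ξ hξ
      simp [hξ]
    simp [h0, hψ]
  · have h1 : ‖ψ‖ₑ ^ 2 ≠ 0 := pow_ne_zero _ (enorm_ne_zero.2 hψ)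
    have h2 : ‖ψ‖ₑ ^ 2 ≠ ∞ := ENNReal.pow_ne_top (by simp)
    rw [ENNReal.mul_lt_top_iff, ENNReal.mul_lt_top_iff]
    simp only [h1, hc0, h2.lt_top, hc.lt_top, true_and, false_or]

end ShearletDilation

theorem mainTheorem6 {d : ℕ} [NeZero d] (H : Subgroup (GL (Fin d) ℝ))
    (hH : ShearletDilation.IsGeneralizedShearletGroup H)
    (μ : Measure H) [μ.IsHaarMeasure] (ψ : ShearletDilation.L2 d) :
    ShearletDilation.IsAdmissible H μ ψ ↔
      ∫⁻ ξ : EuclideanSpace ℝ (Fin d), ‖(𝓕 ψ : ShearletDilation.L2 d) ξ‖ₑ ^ 2 / ‖ξ 0‖ₑ ^ d < ∞ :=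
  ShearletDilation.isAdmissible_iff_lintegral_lt_top H hH μ ψ
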